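/- Theorem. Write $\mathbb{P}^1=\mathbb{P}^1(\mathbb{C})$. Let $\boldsymbol{t}_a: z\mapsto z+a$ ($a\in\mathbb{C}$), $\boldsymbol{s}_\alpha: z\mapsto \alpha z$ ($\alpha\in\mathbb{C}^*$), $\boldsymbol{w}: z\mapsto 1/z$, let $\boldsymbol{e}$ denote the germs of $\exp$ at the points of $\mathbb{C}$, and, for $k\in\mathbb{Z}$, let $\boldsymbol{l}_k$ denote the germs, at the points $p\in\mathbb{C}^*$, of the branch of the logarithm whose value at $p$ lies in the strip $J_k=\{(2k-1)\pi<\mathrm{Im}\,z\le(2k+1)\pi\}$; put $\boldsymbol{l}=\boldsymbol{l}_0$. Products are written so that the rightmost factor is applied first. Let $\mathcal{G}_{\mathrm{PSL}(2,\mathbb{C})}$ be the groupoid, with set of objects $\mathbb{P}^1$, of germs of Möbius transformations, and let $\Gamma\mathcal{G}_{\mathrm{Exp}}$ be the groupoid, with set of objects $\mathbb{P}^1$, of reduced paths in the letters $\boldsymbol{e}$ and $\boldsymbol{l}_k$, i.e. the free groupoid on the graph whose edges are the germs $\boldsymbol{e}: p\to\exp(p)$, $p\in\mathbb{C}$, in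 which the inverse of the edge $\boldsymbol{e}$ with source $p\in J_k$ is $\boldsymbol{l}_k$ with source $\exp(p)$. Let $\mathcal{F}=\mathcal{G}_{\mathrm{PSL}(2,\mathbb{C})}*\Gamma\mathcal{G}_{\mathrm{Exp}}$ be the free product of these groupoids (over the common set of objects $\mathbb{P}^1$), and let $\mathcal{F}/\mathcal{N}(\mathrm{Rel})$ be its quotient by the normal closure of the relations $$\boldsymbol{l}\,\boldsymbol{e}=\boldsymbol{t}_{-2\pi i r}\ \text{ (source of } \boldsymbol{e} \text{ in } J_r,\ r\in\mathbb{Z}),\qquad \boldsymbol{e}\,\boldsymbol{s}_{-1}=\boldsymbol{w}\,\boldsymbol{e},\qquad \boldsymbol{e}\,\boldsymbol{t}_a=\boldsymbol{s}_{\exp(a)}\,\boldsymbol{e}\ (a\in\mathbb{C}),$$ imposed at every point of $\mathbb{C}$ (an equality $u=v$ stands for the relation $uv^{-1}$). Let $\Omega=\{\mathrm{Re}\,\alpha>0\}\cup\{\mathrm{Re}\,\alpha=0,\ \mathrm{Im}\,\alpha>0\}$ and $$T_0=\{\boldsymbol{s}_\rho:\rho\in\Omega\}\cup\{\boldsymbol{s}_\rho\boldsymbol{w}\boldsymbol{t}_b:\rho\in\Omega,\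 b\in\mathbb{C}\},$$ $$T_1=\{\boldsymbol{t}_b:b\in\mathbb{C}\}\cup\{\boldsymbol{t}_a\boldsymbol{w}\boldsymbol{t}_b:a\in\Omega,\ b\in\mathbb{C}^*\setminus\{-1/a\}\}\cup\{\boldsymbol{t}_c\boldsymbol{w}:c\in\mathbb{C}^*\}.$$ A normal form is a path $[g_0,h_1,g_1,\ldots,h_n,g_n]$, $n\ge0$, of composable germs (the source of each entry is the target of the next one) such that: $g_0$ is a germ of a Möbius transformation; each $h_i$ is $\boldsymbol{e}$ or $\boldsymbol{l}$; $g_i$ is a germ of an element of $T_0$ if $h_i=\boldsymbol{e}$, and of an element of $T_1$ if $h_i=\boldsymbol{l}$; and there are no subpaths $[\boldsymbol{e},\mathbb{1},\boldsymbol{l}]$ or $[\boldsymbol{l},\mathbb{1},\boldsymbol{e}]$. Let $\mathrm{NF}$ be the set of normal forms. Then each morphism of $\mathcal{F}/\mathcal{N}(\mathrm{Rel})$ is the class of the product $g_0h_1g_1\cdots h_ng_n\in\mathcal{F}$ of exactly one normal form $[g_0,h_1,g_1,\ldots,h_n,g_n]\in\mathrm{NF}$ (with the same source and target). -/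

import Mathlib

open CategoryTheory Filter Topology

open scoped OnePoint Matrix

namespace ExpMobius

noncomputable section

/-! ### Two constructions for groupoids with a given set of objects -/

/-- The join of the underlying graphs of two groupoids `G`, `H` with the same set of objects `X`:
its edges are the morphisms of `G` together with the morphisms of `H`. -/
def JoinGraph {X : Type} (_G _H : Groupoid.{0} X) : Type := X

instance {X : Type} (G H : Groupoid.{0} X) : Quiver (JoinGraph G H) where
  Hom x y := G.Hom x y ⊕ H.Hom x y

/-- The edge of the join given by a morphism of the first groupoid, in the free groupoid on the
join. -/
def leftLetter {X : Type} (G H : Groupoid.{0} X) {x y : X} (f : G.Hom x y) :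
    (Quiver.FreeGroupoid.of (JoinGraph G H)).obj x ⟶
      (Quiver.FreeGroupoid.of (JoinGraph G H)).obj y :=
  (Quiver.FreeGroupoid.of (JoinGraph G H)).map (X := x) (Y := y) (Sum.inl f)

/-- The edge of the join given by a morphism of the second groupoid, in the free groupoid on the
join. -/
def rightLetter {X : Type} (G H : Groupoid.{0} X) {x y : X} (f : H.Hom x y) :
    (Quiver.FreeGroupoid.of (JoinGraph G H)).obj x ⟶
      (Quiver.FreeGroupoid.of (JoinGraph G H)).obj y :=
  (Quiver.FreeGroupoid.of (JoinGraph G H)).map (X := x) (Y := y) (Sum.inr f)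

/-- The relations that make the inclusions of both groupoids functorial. -/
inductive MulRel {X : Type} (G H : Groupoid.{0} X) : HomRel (Quiver.FreeGroupoid (JoinGraph G H))
  | left {x y z : X} (f : G.Hom x y) (g : G.Hom y z) :
      MulRel G H (leftLetter G H (G.comp f g)) (leftLetter G H f ≫ leftLetter G H g)
  | right {x y z : X} (f : H.Hom x y) (g : H.Hom y z) :
      MulRel G H (rightLetter G H (H.comp f g)) (rightLetter G H f ≫ rightLetter G H g)

/-- The free product `G * H` of two groupoids with the same set of objects: the groupoid
generated by the morphisms of `G` and those of `H`, subject only to the multiplication tables of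
`G` and of `H`. -/
abbrev FreeProduct {X : Type} (G H : Groupoid.{0} X) : Type :=
  CategoryTheory.Quotient (MulRel G H)

namespace FreeProduct

variable {X : Type} (G H : Groupoid.{0} X)

/-- An element of `X`, as an object of the free product. -/
def of (x : X) : FreeProduct G H := ⟨(Quiver.FreeGroupoid.of (JoinGraph G H)).obj x⟩

/-- The inclusion of the first groupoid in the free product. -/
def inl {x y : X} (f : G.Hom x y) : of G H x ⟶ of G H y :=
  (CategoryTheory.Quotient.functor (MulRel G H)).map (leftLetter G H f)

/-- The inclusion of the second groupoid in the free product. -/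
def inr {x y : X} (f : H.Hom x y) : of G H x ⟶ of G H y :=
  (CategoryTheory.Quotient.functor (MulRel G H)).map (rightLetter G H f)

end FreeProduct

/-- The normal closure `N(R)` of a family `R` of relations, at the object `x`: it consists of the
consequences `aₙ⁻¹ ρₙ aₙ ⋯ a₁⁻¹ ρ₁ a₁` of `R` at `x`, where `aᵢ` goes from `x` to some `xᵢ`, and `ρᵢ`
or its inverse belongs to `R xᵢ`. The factor written last is applied first. -/
inductive IsConsequence {F : Type} [Groupoid.{0} F] (R : ∀ y : F, Set (y ⟶ y)) (x : F) :
    (x ⟶ x) → Prop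
  | id : IsConsequence R x (𝟙 x)
  | cons {n : x ⟶ x} {y : F} (a : x ⟶ y) (ρ : y ⟶ y) (hρ : ρ ∈ R y ∨ Groupoid.inv ρ ∈ R y)
      (hn : IsConsequence R x n) : IsConsequence R x (n ≫ a ≫ ρ ≫ Groupoid.inv a)

/-- Two parallel morphisms `f`, `g` are identified modulo the normal closure `N(R)` if `f`
composed with the inverse of `g` belongs to `N(R)`. -/
def ModNormalClosure {F : Type} [Groupoid.{0} F] (R : ∀ y : F, Set (y ⟶ y)) : HomRel F :=
  fun _ d f g => IsConsequence R d (Groupoid.inv g ≫ f)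

/-- The quotient groupoid `F / N(R)` by the normal closure of a family `R` of relations. -/
abbrev QuotientGroupoid {F : Type} [Groupoid.{0} F] (R : ∀ y : F, Set (y ⟶ y)) : Type :=
  CategoryTheory.Quotient (ModNormalClosure R)

/-! ### The Riemann sphere and the groupoid of germs of Möbius transformations -/

/-- The Riemann sphere. -/
abbrev P1 : Type := OnePoint ℂ

/-- A Möbius transformation of the Riemann sphere; `GL(2, ℂ)` and `SL(2, ℂ)` define the same group
of transformations, namely `PSL(2, ℂ)`. -/
def mobius (A : GL (Fin 2) ℂ) (z : P1) : P1 := A • z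

theorem continuous_mobius (A : GL (Fin 2) ℂ) : Continuous (mobius A) := by
  set a := A 0 0 with ha
  set b := A 0 1 with hb
  set c := A 1 0 with hc
  set d := A 1 1 with hd
  have hdet : a * d - b * c ≠ 0 := by
    have h := A.det_ne_zero
    rwa [Matrix.det_fin_two] at h
  have hsome : ∀ z : ℂ, mobius A (z : P1) =
      if c * z + d = 0 then (∞ : P1) else (((a * z + b) / (c * z + d) : ℂ) : P1) :=
    fun z => OnePoint.smul_some_eq_ite
  have hinf : mobius A (∞ : P1) = if c = 0 then (∞ : P1) else ((a / c : ℂ) : P1) :=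
    OnePoint.smul_infty_eq_ite A
  have hcoe : Tendsto ((↑) : ℂ → P1) (Bornology.cobounded ℂ) (𝓝 (∞ : P1)) := by
    have h := OnePoint.tendsto_coe_infty (X := ℂ)
    rwa [coclosedCompact_eq_cocompact, ← Metric.cobounded_eq_cocompact] at h
  rw [OnePoint.continuous_iff, coclosedCompact_eq_cocompact, ← Metric.cobounded_eq_cocompact]
  constructor
  · by_cases hc0 : c = 0
    · have hd0 : d ≠ 0 := by
        rintro h
        exact hdet (by rw [hc0, h]; ring)
      have ha0 : a ≠ 0 := by
        rintro h
        exact hdet (by rw [hc0, h]; ring)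
      rw [hinf, if_pos hc0]
      have h1 : Tendsto (fun z : ℂ => a / d * z + b / d) (Bornology.cobounded ℂ)
          (Bornology.cobounded ℂ) :=
        (tendsto_add_const_cobounded (b / d)).comp
          (tendsto_mul_left_cobounded (div_ne_zero ha0 hd0))
      refine (hcoe.comp h1).congr fun z => ?_
      rw [hsome, hc0, zero_mul, zero_add, if_neg hd0]
      simp only [Function.comp_apply]
      congr 1
      field_simp
    · rw [hinf, if_neg hc0]
      have h1 : Tendsto (fun z : ℂ => c * z + d) (Bornology.cobounded ℂ)
          (Bornology.cobounded ℂ) :=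
        (tendsto_add_const_cobounded d).comp (tendsto_mul_left_cobounded hc0)
      have h2 : Tendsto (fun z : ℂ => a / c + (b - a * d / c) * (c * z + d)⁻¹)
          (Bornology.cobounded ℂ) (𝓝 (a / c)) := by
        have h3 := (tendsto_inv₀_cobounded.comp h1).const_mul (b - a * d / c)
        have h4 := h3.const_add (a / c)
        simpa using h4
      refine Tendsto.congr' ?_ ((OnePoint.continuous_coe.tendsto (a / c)).comp h2)
      filter_upwards [h1.eventually_ne_cobounded 0] with z hz
      rw [hsome, if_neg hz]
      simp only [Function.comp_apply]
      congr 1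
      field_simp
      ring
  · rw [continuous_iff_continuousAt]
    intro k
    by_cases hk : c * k + d = 0
    · have hnum : a * k + b ≠ 0 := by
        intro h
        apply hdet
        by_cases hc0 : c = 0
        · have hd0 : d = 0 := by simpa [hc0] using hk
          rw [hc0, hd0]; ring
        · have : c * (a * d - b * c) = 0 := by
            linear_combination (a * c) * hk - c * c * h
          exact (mul_eq_zero.mp this).resolve_left hc0
      have hc0 : c ≠ 0 := by
        rintro h
        have hd0 : d = 0 := by simpa [h] using hk
        exact hdet (by rw [h, hd0]; ring)
      have hne : ∀ z : ℂ, z ≠ k → c * z + d ≠ 0 := by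
        intro z hz h
        apply hz
        have : c * (z - k) = 0 := by linear_combination h - hk
        exact sub_eq_zero.mp ((mul_eq_zero.mp this).resolve_left hc0)
      have h1 : Tendsto (fun z : ℂ => c * z + d) (𝓝[≠] k) (𝓝[≠] 0) := by
        refine tendsto_nhdsWithin_iff.mpr ⟨?_, ?_⟩
        · have : Tendsto (fun z : ℂ => c * z + d) (𝓝 k) (𝓝 (c * k + d)) :=
            (by fun_prop : Continuous fun z : ℂ => c * z + d).tendsto k
          rw [hk] at this
          exact this.mono_left nhdsWithin_le_nhds
        · filter_upwards [self_mem_nhdsWithin] with z hz using hne z hz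
      have h2 : Tendsto (fun z : ℂ => a / c + (b - a * d / c) * (c * z + d)⁻¹) (𝓝[≠] k)
          (Bornology.cobounded ℂ) := by
        have h0 : b - a * d / c ≠ 0 := by
          intro h
          apply hdet
          field_simp at h
          linear_combination -h
        exact (tendsto_const_add_cobounded (a / c)).comp
          ((tendsto_mul_left_cobounded h0).comp (tendsto_inv₀_nhdsNE_zero.comp h1))
      have hval : mobius A (k : P1) = ∞ := by rw [hsome, if_pos hk]
      rw [continuousAt_iff_punctured_nhds, hval]
      refine (hcoe.comp h2).congr' ?_
      filter_upwards [self_mem_nhdsWithin] with z hz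
      rw [hsome, if_neg (hne z hz)]
      simp only [Function.comp_apply]
      congr 1
      have := hne z hz
      field_simp
      ring
    · have hcont : ContinuousAt (fun z : ℂ => c * z + d) k := by fun_prop
      have h1 : ContinuousAt (fun z : ℂ => (a * z + b) / (c * z + d)) k :=
        ContinuousAt.div (by fun_prop) hcont hk
      refine ContinuousAt.congr (OnePoint.continuous_coe.continuousAt.comp h1) ?_
      filter_upwards [hcont.eventually_ne hk] with z hz
      rw [hsome, if_neg hz]
      rfl

/-- The translation `z ↦ z + a`. -/
def trans (a : ℂ) : GL (Fin 2) ℂ :=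
  Matrix.GeneralLinearGroup.mkOfDetNeZero !![1, a; 0, 1] (by simp)

/-- The scaling `z ↦ α z`. -/
def scale (α : ℂˣ) : GL (Fin 2) ℂ :=
  Matrix.GeneralLinearGroup.mkOfDetNeZero !![(α : ℂ), 0; 0, 1] (by simp)

/-- The involution `z ↦ 1 / z`. -/
def invol : GL (Fin 2) ℂ :=
  Matrix.GeneralLinearGroup.mkOfDetNeZero !![0, 1; 1, 0] (by simp)

theorem mobius_trans (a z : ℂ) : mobius (trans a) (z : P1) = ((z + a : ℂ) : P1) := by
  simp [mobius, trans, OnePoint.smul_some_eq_ite]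

theorem mobius_scale (α : ℂˣ) (z : ℂ) : mobius (scale α) (z : P1) = ((α * z : ℂ) : P1) := by
  simp [mobius, scale, OnePoint.smul_some_eq_ite]

theorem mobius_invol {z : ℂ} (hz : z ≠ 0) : mobius invol (z : P1) = ((z⁻¹ : ℂ) : P1) := by
  simp [mobius, invol, OnePoint.smul_some_eq_ite, hz]

/-- Germs at `p`, with value `q` at `p`, of Möbius transformations. -/
def MobiusGerm (p q : P1) : Type :=
  {φ : Germ (𝓝 p) P1 // ∃ A : GL (Fin 2) ℂ, mobius A p = q ∧ φ = (mobius A : Germ (𝓝 p) P1)}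

namespace MobiusGerm

/-- The germ at `p` of the Möbius transformation `A`. -/
def mk (A : GL (Fin 2) ℂ) {p q : P1} (h : mobius A p = q) : MobiusGerm p q :=
  ⟨(mobius A : Germ (𝓝 p) P1), A, h, rfl⟩

theorem tendsto {p q : P1} (f : MobiusGerm p q) : f.1.Tendsto (𝓝 q) := by
  obtain ⟨φ, A, h, rfl⟩ := f
  subst h
  exact (continuous_mobius A).continuousAt

/-- Composition of germs, `f` being applied first. -/
def comp {p q r : P1} (f : MobiusGerm p q) (g : MobiusGerm q r) : MobiusGerm p r :=
  ⟨g.1.compTendsto' f.1 f.tendsto, by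
    obtain ⟨φ, A, rfl, rfl⟩ := f
    obtain ⟨ψ, B, rfl, rfl⟩ := g
    exact ⟨B * A, mul_smul B A p, congrArg _ (funext fun z => (mul_smul B A z).symm)⟩⟩

/-- The inverse of a germ. -/
def symm {p q : P1} (f : MobiusGerm p q) : MobiusGerm q p :=
  mk f.2.choose⁻¹ (inv_smul_eq_iff.mpr f.2.choose_spec.1.symm)

theorem comp_symm {p q : P1} (f : MobiusGerm p q) :
    f.comp f.symm = mk 1 (one_smul _ p) := by
  obtain ⟨A, h, hA⟩ : ∃ A, ∃ h : mobius A p = q, f = mk A h ∧ f.symm = mk A⁻¹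
      (inv_smul_eq_iff.mpr h.symm) :=
    ⟨f.2.choose, f.2.choose_spec.1, Subtype.ext f.2.choose_spec.2, rfl⟩
  rw [hA.2, hA.1]
  exact Subtype.ext (congrArg Germ.ofFun (funext fun z => (inv_smul_smul A z).trans (one_smul _ z).symm))

theorem symm_comp {p q : P1} (f : MobiusGerm p q) :
    f.symm.comp f = mk 1 (one_smul _ q) := by
  obtain ⟨A, h, hA⟩ : ∃ A, ∃ h : mobius A p = q, f = mk A h ∧ f.symm = mk A⁻¹
      (inv_smul_eq_iff.mpr h.symm) :=
    ⟨f.2.choose, f.2.choose_spec.1, Subtype.ext f.2.choose_spec.2, rfl⟩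
  rw [hA.2, hA.1]
  exact Subtype.ext (congrArg Germ.ofFun (funext fun z => (smul_inv_smul A z).trans (one_smul _ z).symm))

end MobiusGerm

/-- The groupoid of germs of elements of `PSL(2, ℂ)`, with the points of the Riemann sphere as
objects. -/
@[reducible] def mobiusGroupoid : Groupoid.{0} P1 where
  Hom := MobiusGerm
  id p := MobiusGerm.mk 1 (one_smul _ p)
  comp := MobiusGerm.comp
  inv := MobiusGerm.symm
  id_comp f := by
    obtain ⟨φ, A, rfl, rfl⟩ := f
    exact Subtype.ext (congrArg Germ.ofFun (funext fun z => congrArg (mobius A) (one_smul _ z)))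
  comp_id f := by
    obtain ⟨φ, A, rfl, rfl⟩ := f
    exact Subtype.ext (congrArg Germ.ofFun (funext fun z => one_smul _ (mobius A z)))
  assoc f g h := by
    obtain ⟨φ, A, rfl, rfl⟩ := f
    obtain ⟨ψ, B, rfl, rfl⟩ := g
    obtain ⟨χ, C, rfl, rfl⟩ := h
    rfl
  inv_comp f := f.symm_comp
  comp_inv f := f.comp_symm

/-! ### The free groupoid on the graph of the germs of the exponential -/

/-- The exponential on the finite part of the sphere; the value at infinity is irrelevant, since
only germs at finite points are used. -/
def expMap : P1 → P1 := OnePoint.map Complex.exp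

/-- Germs of the exponential, from a finite point `p` to `q = exp p`. -/
def ExpGerm (p q : P1) : Type :=
  {φ : Germ (𝓝 p) P1 // (∃ z : ℂ, p = z ∧ q = (Complex.exp z : ℂ)) ∧ φ = (expMap : Germ (𝓝 p) P1)}

/-- The graph whose vertices are the points of the Riemann sphere and whose edges are the germs of
the exponential map at the points of `ℂ`. -/
def ExpGraph : Type := P1

instance : Quiver ExpGraph where
  Hom p q := ExpGerm p q

/-- The groupoid of reduced paths in the germs of `exp` and of the branches of `log`, i.e. the
free groupoid on the graph of germs of `exp`; the inverse of the edge given by the germ of `exp`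
at `w` is the germ at `exp w` of the branch of `log` with value `w`. -/
@[reducible] def expGroupoid : Groupoid.{0} P1 where
  Hom p q := (Quiver.FreeGroupoid.of ExpGraph).obj p ⟶ (Quiver.FreeGroupoid.of ExpGraph).obj q
  id p := 𝟙 ((Quiver.FreeGroupoid.of ExpGraph).obj p)
  comp f g := f ≫ g
  inv f := Groupoid.inv f
  id_comp f := Category.id_comp f
  comp_id f := Category.comp_id f
  assoc f g h := Category.assoc f g h
  inv_comp f := Groupoid.inv_comp f
  comp_inv f := Groupoid.comp_inv f

/-- The germ of `exp` from `p` to `q`, as a generator of the free groupoid. -/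
def expEdge {p q : P1} (h : ∃ z : ℂ, p = z ∧ q = (Complex.exp z : ℂ)) : expGroupoid.Hom p q :=
  (Quiver.FreeGroupoid.of ExpGraph).map (X := p) (Y := q) ⟨(expMap : Germ (𝓝 p) P1), h, rfl⟩

/-- The germ at `p ∈ ℂ \ {0}` of the branch of the logarithm with the principal value
`q = log p`. -/
def logEdge {p q : P1} (h : ∃ u : ℂ, u ≠ 0 ∧ p = u ∧ q = (Complex.log u : ℂ)) :
    expGroupoid.Hom p q :=
  expGroupoid.inv (expEdge (p := q) (q := p) (by
    obtain ⟨u, hu, rfl, rfl⟩ := h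
    exact ⟨Complex.log u, rfl, by rw [Complex.exp_log hu]⟩))

/-! ### The free product and its quotient -/

/-- The free product of the groupoid of germs of Möbius transformations and of the free groupoid
on the graph of germs of `exp`. -/
abbrev F : Type := FreeProduct mobiusGroupoid expGroupoid

/-- A point of the sphere as an object of the free product. -/
abbrev F.of (p : P1) : F := FreeProduct.of mobiusGroupoid expGroupoid p

/-- The germ of a Möbius transformation, in the free product. -/
def F.mob (A : GL (Fin 2) ℂ) {p q : P1} (h : mobius A p = q) : F.of p ⟶ F.of q :=
  FreeProduct.inl mobiusGroupoid expGroupoid (MobiusGerm.mk A h)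

/-- The germ of `exp` at `z`, in the free product. -/
def F.e (z : ℂ) : F.of z ⟶ F.of (Complex.exp z : ℂ) :=
  FreeProduct.inr mobiusGroupoid expGroupoid (expEdge ⟨z, rfl, rfl⟩)

/-- The germ of the principal branch of `log` at `u ≠ 0`, in the free product. -/
def F.l (u : ℂ) (hu : u ≠ 0) : F.of u ⟶ F.of (Complex.log u : ℂ) :=
  FreeProduct.inr mobiusGroupoid expGroupoid (logEdge ⟨u, hu, rfl, rfl⟩)

/-- The horizontal strip which is the image of the `r`-th branch of the logarithm. -/
def strip (r : ℤ) : Set ℂ := {z | (2 * r - 1) * Real.pi < z.im ∧ z.im ≤ (2 * r + 1) * Real.pi}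

theorem log_exp_of_mem_strip {r : ℤ} {z : ℂ} (hz : z ∈ strip r) :
    Complex.log (Complex.exp z) = z + -(2 * Real.pi * Complex.I * r) := by
  have hexp : Complex.exp (z + -(2 * Real.pi * Complex.I * r)) = Complex.exp z := by
    rw [Complex.exp_eq_exp_iff_exists_int]
    exact ⟨-r, by push_cast; ring⟩
  have him : (z + -(2 * Real.pi * Complex.I * r)).im = z.im - 2 * Real.pi * r := by
    simp
    ring
  obtain ⟨h1, h2⟩ := hz
  rw [← hexp]
  apply Complex.log_exp
  · rw [him]; linarith
  · rw [him]; linarith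

/-- The relations, as pairs of parallel morphisms of the free product. Composition is written in
the order of application: `f ≫ g` is `f` followed by `g`. -/
inductive RelPair : ∀ {c d : F}, (c ⟶ d) → (c ⟶ d) → Prop
  /-- `l e = t_{-2πir}` at the points of the `r`-th strip. -/
  | log_exp (r : ℤ) (z : ℂ) (hz : z ∈ strip r) :
      RelPair (F.e z ≫ F.l (Complex.exp z) (Complex.exp_ne_zero z))
        (F.mob (trans (-(2 * Real.pi * Complex.I * r)))
          (by rw [mobius_trans, log_exp_of_mem_strip hz]))
  /-- `e s_{-1} = w e`. -/
  | exp_neg (z : ℂ) :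
      RelPair (F.mob (scale (-1)) (by rw [mobius_scale]; simp) ≫ F.e (-z))
        (F.e z ≫ F.mob invol (by rw [mobius_invol (Complex.exp_ne_zero z), Complex.exp_neg]))
  /-- `e t_a = s_{exp a} e`. -/
  | exp_add (a z : ℂ) :
      RelPair (F.mob (trans a) (mobius_trans a z) ≫ F.e (z + a))
        (F.e z ≫ F.mob (scale (Units.mk0 (Complex.exp a) (Complex.exp_ne_zero a)))
          (by rw [mobius_scale, Units.val_mk0, Complex.exp_add, mul_comm]))

/-- The set of relations at an object: the morphisms `u ∘ v⁻¹` for the pairs `u = v` above. -/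
def Rel (d : F) : Set (d ⟶ d) :=
  {γ | ∃ (c : F) (u v : c ⟶ d), RelPair u v ∧ γ = Groupoid.inv v ≫ u}

/-- The quotient groupoid `F / N(Rel)`. -/
abbrev Q : Type := QuotientGroupoid Rel

/-- The projection `F → F / N(Rel)`. -/
abbrev proj : F ⥤ Q := CategoryTheory.Quotient.functor (ModNormalClosure Rel)

/-! ### Normal forms -/

/-- The region `Ω`, a fundamental domain of `z ↦ -z` on `ℂ \ {0}`. -/
def Omega : Set ℂ := {α | 0 < α.re ∨ (α.re = 0 ∧ 0 < α.im)}

/-- The transversal `T₀` for the right cosets of `H₀ = {z ↦ ± z + a}`. -/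
def T0 : Set (GL (Fin 2) ℂ) :=
  {A | ∃ ρ : ℂˣ, (ρ : ℂ) ∈ Omega ∧ A = scale ρ} ∪
    {A | ∃ (ρ : ℂˣ) (b : ℂ), (ρ : ℂ) ∈ Omega ∧ A = scale ρ * invol * trans b}

/-- The transversal `T₁` for the right cosets of `H₁ = {z ↦ α z} ∪ {z ↦ α / z}`. -/
def T1 : Set (GL (Fin 2) ℂ) :=
  {A | ∃ b : ℂ, A = trans b} ∪
    {A | ∃ a b : ℂ, a ∈ Omega ∧ b ≠ 0 ∧ b ≠ -1 / a ∧ A = trans a * invol * trans b} ∪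
    {A | ∃ c : ℂ, c ≠ 0 ∧ A = trans c * invol}

/-- The two kinds of symbols `e` and `l`. -/
inductive Kind
  | e
  | l

/-- The transversal attached to the symbols `e` and `l`. -/
def Kind.transversal : Kind → Set (GL (Fin 2) ℂ)
  | .e => T0
  | .l => T1

/-- The symbol `e` (resp. `l`) is the name of a germ from `p` to `q`: `p` is a finite point and
`q = exp p` (resp. `p` is finite and nonzero and `q` is the principal value of `log p`). -/
def Kind.Joins : Kind → P1 → P1 → Prop
  | .e, p, q => ∃ z : ℂ, p = z ∧ q = (Complex.exp z : ℂ)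
  | .l, p, q => ∃ u : ℂ, u ≠ 0 ∧ p = u ∧ q = (Complex.log u : ℂ)

/-- The germ `e` or `l` from `p` to `q`, as a generator of the free groupoid or its inverse. -/
def Kind.edge : ∀ (k : Kind) {p q : P1}, k.Joins p q → expGroupoid.Hom p q
  | .e, _, _, h => expEdge h
  | .l, _, _, h => logEdge h

/-- Paths `[h₁, g₁, …, hₙ, gₙ]`, `n ≥ 0`, from `x` to `y`, where each `hᵢ` is a germ `e` or `l` and
each `gᵢ` is the germ of a Möbius transformation; the last entry is applied first. -/
inductive Tail : P1 → P1 → Type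
  | nil (x : P1) : Tail x x
  | cons {x u v y : P1} (k : Kind) (h : k.Joins v y) (g : MobiusGerm u v) (p : Tail x u) : Tail x y

/-- The morphism `h₁ g₁ ⋯ hₙ gₙ` of the free product defined by a path. -/
def Tail.toF : ∀ {x y : P1}, Tail x y → (F.of x ⟶ F.of y)
  | _, _, .nil x => 𝟙 (F.of x)
  | _, _, .cons k h g p =>
      p.toF ≫ FreeProduct.inl mobiusGroupoid expGroupoid g ≫
        FreeProduct.inr mobiusGroupoid expGroupoid (k.edge h)

/-- `p` is empty or its first symbol is `k`. -/
def Tail.HeadIs {x y : P1} (k : Kind) : Tail x y → Prop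
  | .nil _ => True
  | .cons k' _ _ _ => k' = k

/-- The conditions on a path `[h₁, g₁, …, hₙ, gₙ]` in the definition of a normal form: `gᵢ` is
the germ of an element of `T₀` if `hᵢ = e` and of `T₁` if `hᵢ = l`, and there are no subpaths
`[e, 𝟙, l]` or `[l, 𝟙, e]`. -/
def Tail.IsNormal : ∀ {x y : P1}, Tail x y → Prop
  | _, _, .nil _ => True
  | _, _, .cons (u := u) k _ g p =>
      (∃ A ∈ k.transversal, g.1 = (mobius A : Germ (𝓝 u) P1)) ∧
        (g.1 = ((fun z => z : P1 → P1) : Germ (𝓝 u) P1) → p.HeadIs k) ∧ p.IsNormal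

/-- Normal forms `[g₀, h₁, g₁, …, hₙ, gₙ]` with source `x` and target `y`. -/
structure NormalForm (x y : P1) where
  {mid : P1}
  g₀ : MobiusGerm mid y
  tail : Tail x mid
  isNormal : tail.IsNormal

/-- The morphism `g₀ h₁ g₁ ⋯ hₙ gₙ` of the free product defined by a normal form. -/
def NormalForm.toF {x y : P1} (g : NormalForm x y) : F.of x ⟶ F.of y :=
  g.tail.toF ≫ FreeProduct.inl mobiusGroupoid expGroupoid g.g₀

end

end ExpMobius

/-!
The quotient `F / N(Rel)` is an HNN extension of the groupoid of Möbius germs: the germs of `exp`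
conjugate the germs at points of `ℂ` of the group `H₀ = {z ↦ ± z + a}` to the germs at points of
`ℂ \ {0}` of the group `H₁ = {z ↦ α z} ∪ {z ↦ α / z}`. The relations `e s_{-1} = w e` and
`e t_a = s_{exp a} e` say this (`ExpConj`), and `l e = t_{-2πir}` is the case of a translation by a
period, which is conjugated to the identity. The sets `T₀` and `T₁` are transversals for the right
cosets of `H₀` and `H₁` (`exists_factorization`, `transversal_unique`), so the theorem is the normal
form theorem for such an extension, and it is proved by van der Waerden's method: the groupoid acts
on its set of normal forms.

For a fixed source `x`, a Möbius germ acts on normal forms by multiplication of the first entry. A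
germ of `exp` or of a branch of `log` is pushed through the factorization `g₀ = h τ` of the first
entry, `k h τ = h' k τ`, unless `τ = 1` and the next symbol is the inverse of `k`, when the two
symbols cancel. Cancellation for `k` is the same as pushing `k⁻¹`, read backwards, so that the
single relation `NormalForm.Push` describes both. It follows that multiplication by a germ `k` is a
well-defined map (`NormalForm.existsUnique_step`) with inverse the multiplication by `k⁻¹`. The
action is compatible with conjugation (`NormalForm.Step.mul`), hence it descends to the quotient
(`act_eq_of_proj_eq`).

A normal form is recovered from its class by acting on the trivial normal form (`act_toF`), which
gives uniqueness. Conversely, the action of a morphism multiplies the class of a normal form by that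
of the morphism (`actsByMul`), so every morphism `γ` is represented by the normal form obtained by
letting `γ` act on the trivial one, which gives existence.
-/

namespace ExpMobius

/-! ### Möbius transformations and their matrices -/

theorem mobius_mul (A B : GL (Fin 2) ℂ) (z : P1) : mobius (A * B) z = mobius A (mobius B z) :=
  mul_smul A B z

/-- If two Möbius transformations agree at a finite point, then cross-multiplying the two
fractions gives an equality, also where the common value is infinite. -/
theorem cross_mul_of_mobius_eq {A B : GL (Fin 2) ℂ} {z : ℂ} (h : mobius A z = mobius B z) :
    (A 0 0 * z + A 0 1) * (B 1 0 * z + B 1 1) = (B 0 0 * z + B 0 1) * (A 1 0 * z + A 1 1) := by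
  simp only [mobius, OnePoint.smul_some_eq_ite] at h
  split_ifs at h with h1 h2 h2
  · rw [h1, h2, mul_zero, mul_zero]
  · exact absurd h (OnePoint.infty_ne_coe _)
  · exact absurd h (OnePoint.coe_ne_infty _)
  · exact (div_eq_div_iff h1 h2).mp (OnePoint.coe_injective h)

theorem det_entries_ne_zero (A : GL (Fin 2) ℂ) : A 0 0 * A 1 1 - A 0 1 * A 1 0 ≠ 0 := by
  have h := A.det_ne_zero
  rwa [Matrix.det_fin_two] at h

/-- Two Möbius transformations with the same germ at some point have proportional matrices: the
cross-multiplied identity is polynomial, and it holds on an infinite set. -/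
theorem exists_smul_of_germ_eq {A B : GL (Fin 2) ℂ} {p : P1}
    (h : (mobius A : Germ (𝓝 p) P1) = mobius B) : ∃ c : ℂ, c ≠ 0 ∧ ∀ i j, A i j = c * B i j := by
  have hset : {q : P1 | mobius A q = mobius B q} ∈ 𝓝 p := Germ.coe_eq.mp h
  have hinf : {z : ℂ | mobius A z = mobius B z}.Infinite := by
    have h1 := (infinite_of_mem_nhds p hset).sdiff (Set.finite_singleton (∞ : P1))
    refine Set.Infinite.of_image ((↑) : ℂ → P1) (h1.mono ?_)
    rintro q ⟨hq, hq'⟩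
    induction q using OnePoint.rec with
    | infty => exact absurd rfl hq'
    | coe z => exact ⟨z, hq, rfl⟩
  have hdA := det_entries_ne_zero A
  have hdB := det_entries_ne_zero B
  have hcross : ∀ z ∈ {z : ℂ | mobius A z = mobius B z}, _ := fun z hz =>
    cross_mul_of_mobius_eq (z := z) hz
  revert hdA hdB hcross
  generalize ha : A 0 0 = a
  generalize hb : A 0 1 = b
  generalize hc : A 1 0 = c
  generalize hd : A 1 1 = d
  generalize ha' : B 0 0 = a'
  generalize hb' : B 0 1 = b'
  generalize hc' : B 1 0 = c'
  generalize hd' : B 1 1 = d'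
  intro hdA hdB hcross
  have hquad : ∀ u v w : ℂ, (∀ z ∈ {z : ℂ | mobius A z = mobius B z}, u * z ^ 2 + v * z + w = 0) →
      u = 0 ∧ v = 0 ∧ w = 0 := by
    intro u v w huvw
    have hP : (.C u * .X ^ 2 + .C v * .X + .C w : Polynomial ℂ) = 0 :=
      Polynomial.eq_zero_of_infinite_isRoot _ (hinf.mono fun z hz => by
        simpa [Polynomial.IsRoot] using huvw z hz)
    refine ⟨?_, ?_, ?_⟩
    · simpa [Polynomial.coeff_C, Polynomial.coeff_X] using congrArg (Polynomial.coeff · 2) hP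
    · simpa [Polynomial.coeff_C, Polynomial.coeff_X] using congrArg (Polynomial.coeff · 1) hP
    · simpa [Polynomial.coeff_C, Polynomial.coeff_X] using congrArg (Polynomial.coeff · 0) hP
  obtain ⟨h2, h1, h0⟩ := hquad (a * c' - a' * c) (a * d' + b * c' - a' * d - b' * c)
    (b * d' - b' * d) fun z hz => by linear_combination hcross z hz
  have e1 : a * (a' * d' - b' * c') = (a * d' - b' * c) * a' := by linear_combination -b' * h2
  have e2 : b * (a' * d' - b' * c') = (a * d' - b' * c) * b' := by
    linear_combination a' * h0 - b' * h1
  have e3 : c * (a' * d' - b' * c') = (a * d' - b' * c) * c' := by linear_combination -d' * h2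
  have e4 : d * (a' * d' - b' * c') = (a * d' - b' * c) * d' := by
    linear_combination c' * h0 - d' * h1
  refine ⟨(a * d' - b' * c) / (a' * d' - b' * c'), div_ne_zero ?_ hdB, fun i j => ?_⟩
  · intro h
    rw [h, zero_mul] at e1 e2
    exact hdA (by
      rw [(mul_eq_zero.mp e1).resolve_right hdB, (mul_eq_zero.mp e2).resolve_right hdB]; ring)
  · fin_cases i <;> fin_cases j <;>
      simp only [Fin.zero_eta, Fin.mk_one, ha, hb, hc, hd, ha', hb', hc', hd'] <;>
      rw [div_mul_eq_mul_div, eq_div_iff hdB] <;> assumption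

theorem mobius_eq_of_smul {A B : GL (Fin 2) ℂ} {c : ℂ} (hc : c ≠ 0)
    (h : ∀ i j, A i j = c * B i j) : mobius A = mobius B := by
  funext z
  induction z using OnePoint.rec with
  | infty =>
    simp only [mobius, OnePoint.smul_infty_eq_ite, h, mul_eq_zero, hc, false_or,
      mul_div_mul_left _ _ hc]
  | coe z =>
    have h1 : c * B 1 0 * z + c * B 1 1 = c * (B 1 0 * z + B 1 1) := by ring
    have h2 : c * B 0 0 * z + c * B 0 1 = c * (B 0 0 * z + B 0 1) := by ring
    simp only [mobius, OnePoint.smul_some_eq_ite, h, h1, h2, mul_eq_zero, hc, false_or,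
      mul_div_mul_left _ _ hc]

/-- A Möbius transformation is determined by its germ at any point. -/
theorem mobius_eq_of_germ_eq {A B : GL (Fin 2) ℂ} {p : P1}
    (h : (mobius A : Germ (𝓝 p) P1) = mobius B) : mobius A = mobius B := by
  obtain ⟨c, hc, hAB⟩ := exists_smul_of_germ_eq h
  exact mobius_eq_of_smul hc hAB

theorem exists_smul_of_mobius_eq {A B : GL (Fin 2) ℂ} (h : mobius A = mobius B) :
    ∃ c : ℂ, c ≠ 0 ∧ ∀ i j, A i j = c * B i j :=
  exists_smul_of_germ_eq (p := ∞) (by rw [h])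

theorem coe_trans (a : ℂ) : (trans a : Matrix (Fin 2) (Fin 2) ℂ) = !![1, a; 0, 1] := rfl

theorem coe_scale (α : ℂˣ) : (scale α : Matrix (Fin 2) (Fin 2) ℂ) = !![(α : ℂ), 0; 0, 1] := rfl

theorem coe_invol : (invol : Matrix (Fin 2) (Fin 2) ℂ) = !![0, 1; 1, 0] := rfl

theorem trans_zero : trans 0 = 1 := by
  ext i j; fin_cases i <;> fin_cases j <;> simp [coe_trans]

theorem scale_one : scale 1 = 1 := by
  ext i j; fin_cases i <;> fin_cases j <;> simp [coe_scale]

/-! ### The subgroups `H₀`, `H₁` and their transversals -/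

theorem neg_notMem_Omega {z : ℂ} (hz : z ∈ Omega) : -z ∉ Omega := by
  simp only [Omega, Set.mem_ofPred_eq, Complex.neg_re, Complex.neg_im] at *
  rintro (h | ⟨h, h2⟩) <;> rcases hz with h' | ⟨h', h2'⟩ <;> linarith

theorem ne_zero_of_mem_Omega {z : ℂ} (hz : z ∈ Omega) : z ≠ 0 := by
  rintro rfl
  exact neg_notMem_Omega hz (by rwa [neg_zero])

theorem mem_Omega_or_neg_mem {z : ℂ} (hz : z ≠ 0) : z ∈ Omega ∨ -z ∈ Omega := by
  simp only [Omega, Set.mem_ofPred_eq, Complex.neg_re, Complex.neg_im]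
  rcases lt_trichotomy z.re 0 with h | h | h
  · right; left; linarith
  · rcases lt_trichotomy z.im 0 with h' | h' | h'
    · right; right; constructor <;> linarith
    · exact absurd (Complex.ext h h') hz
    · left; right; exact ⟨h, h'⟩
  · left; left; exact h

/-- The subgroups `H₀ = {z ↦ ± z + a}` (for `e`) and `H₁ = {z ↦ α z} ∪ {z ↦ α / z}` (for `l`). -/
def Kind.subgroup : Kind → Set (GL (Fin 2) ℂ)
  | .e => {A | ∃ a : ℂ, A = trans a ∨ A = trans a * scale (-1)}
  | .l => {A | ∃ α : ℂˣ, A = scale α ∨ A = scale α * invol}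

theorem one_mem_transversal (k : Kind) : 1 ∈ k.transversal := by
  cases k
  · exact .inl ⟨1, .inl (by simp), scale_one.symm⟩
  · exact .inl (.inl ⟨0, trans_zero.symm⟩)

theorem exists_factorization_e (A : GL (Fin 2) ℂ) :
    ∃ h ∈ Kind.e.subgroup, ∃ τ ∈ T0, mobius A = mobius (h * τ) := by
  have hdet := det_entries_ne_zero A
  by_cases hc : A 1 0 = 0
  · rw [hc, mul_zero, sub_zero] at hdet
    have ha := left_ne_zero_of_mul hdet
    have hd := right_ne_zero_of_mul hdet
    rcases mem_Omega_or_neg_mem (div_ne_zero ha hd) with hΩ | hΩ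
    · refine ⟨_, ⟨A 0 1 / A 1 1, .inl rfl⟩, _, .inl ⟨Units.mk0 _ (div_ne_zero ha hd), hΩ, rfl⟩,
        mobius_eq_of_smul hd fun i j => ?_⟩
      fin_cases i <;> fin_cases j <;> simp [coe_trans, coe_scale, hc] <;> field_simp
    · refine ⟨_, ⟨A 0 1 / A 1 1, .inr rfl⟩, _,
        .inl ⟨Units.mk0 _ (neg_ne_zero.mpr (div_ne_zero ha hd)), hΩ, rfl⟩,
        mobius_eq_of_smul hd fun i j => ?_⟩
      fin_cases i <;> fin_cases j <;> simp [coe_trans, coe_scale, hc] <;> field_simp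
  · have hβ : (A 0 1 * A 1 0 - A 0 0 * A 1 1) / A 1 0 ^ 2 ≠ 0 :=
      div_ne_zero (by rw [← neg_sub]; exact neg_ne_zero.mpr hdet) (pow_ne_zero 2 hc)
    -- `A` is `z ↦ a / c + β / (z + d / c)`.
    rcases mem_Omega_or_neg_mem hβ with hΩ | hΩ
    · refine ⟨_, ⟨A 0 0 / A 1 0, .inl rfl⟩, _,
        .inr ⟨Units.mk0 _ hβ, A 1 1 / A 1 0, hΩ, rfl⟩,
        mobius_eq_of_smul hc fun i j => ?_⟩
      fin_cases i <;> fin_cases j <;> simp [coe_trans, coe_scale, coe_invol] <;> field_simp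
      ring
    · refine ⟨_, ⟨A 0 0 / A 1 0, .inr rfl⟩, _,
        .inr ⟨Units.mk0 _ (neg_ne_zero.mpr hβ), A 1 1 / A 1 0, hΩ, rfl⟩,
        mobius_eq_of_smul hc fun i j => ?_⟩
      fin_cases i <;> fin_cases j <;> simp [coe_trans, coe_scale, coe_invol] <;> field_simp
      ring

theorem exists_factorization_l (A : GL (Fin 2) ℂ) :
    ∃ h ∈ Kind.l.subgroup, ∃ τ ∈ T1, mobius A = mobius (h * τ) := by
  have hdet := det_entries_ne_zero A
  by_cases hc : A 1 0 = 0
  · rw [hc, mul_zero, sub_zero] at hdet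
    have ha := left_ne_zero_of_mul hdet
    have hd := right_ne_zero_of_mul hdet
    refine ⟨_, ⟨Units.mk0 _ (div_ne_zero ha hd), .inl rfl⟩, _,
      .inl (.inl ⟨A 0 1 / A 0 0, rfl⟩), mobius_eq_of_smul hd fun i j => ?_⟩
    fin_cases i <;> fin_cases j <;> simp [coe_trans, coe_scale, hc] <;> field_simp
  by_cases ha : A 0 0 = 0
  · rw [ha, zero_mul, zero_sub, neg_ne_zero] at hdet
    have hb := left_ne_zero_of_mul hdet
    refine ⟨_, ⟨Units.mk0 _ (div_ne_zero hb hc), .inr rfl⟩, _,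
      .inl (.inl ⟨A 1 1 / A 1 0, rfl⟩), mobius_eq_of_smul hc fun i j => ?_⟩
    fin_cases i <;> fin_cases j <;> simp [coe_trans, coe_scale, coe_invol, ha] <;> field_simp
  by_cases hd : A 1 1 = 0
  · rw [hd, mul_zero, zero_sub, neg_ne_zero] at hdet
    have hb := left_ne_zero_of_mul hdet
    refine ⟨_, ⟨Units.mk0 _ (div_ne_zero hb hc), .inl rfl⟩, _,
      .inr ⟨A 0 0 / A 0 1, div_ne_zero ha hb, rfl⟩, mobius_eq_of_smul hc fun i j => ?_⟩
    fin_cases i <;> fin_cases j <;> simp [coe_trans, coe_scale, coe_invol, hd] <;> field_simp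
  by_cases hb : A 0 1 = 0
  · refine ⟨_, ⟨Units.mk0 _ (div_ne_zero ha hd), .inr rfl⟩, _,
      .inr ⟨A 1 0 / A 1 1, div_ne_zero hc hd, rfl⟩, mobius_eq_of_smul hd fun i j => ?_⟩
    fin_cases i <;> fin_cases j <;> simp [coe_trans, coe_scale, coe_invol, hb] <;> field_simp
  -- `b / a` and `d / c` are the negatives of the zero and of the pole of `A`; the sign of `x`
  -- decides which of the two becomes the pole of the representative.
  obtain ⟨D, hD⟩ : ∃ D, D = A 0 1 * A 1 0 - A 0 0 * A 1 1 := ⟨_, rfl⟩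
  have hD0 : D ≠ 0 := by rw [hD, ← neg_sub]; exact neg_ne_zero.mpr hdet
  have hx : A 0 0 * A 1 0 / D ≠ 0 := div_ne_zero (mul_ne_zero ha hc) hD0
  rcases mem_Omega_or_neg_mem hx with hΩ | hΩ
  · refine ⟨_, ⟨Units.mk0 (D / A 1 0 ^ 2) (div_ne_zero hD0 (pow_ne_zero 2 hc)), .inl rfl⟩, _,
      .inl (.inr ⟨_, A 1 1 / A 1 0, hΩ, div_ne_zero hd hc, fun h => hb ?_, rfl⟩),
      mobius_eq_of_smul hc fun i j => ?_⟩
    · field_simp at h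
      have : A 1 0 * A 0 1 = 0 := by linear_combination h - hD
      exact (mul_eq_zero.mp this).resolve_left hc
    · fin_cases i <;> fin_cases j <;> simp [coe_trans, coe_scale, coe_invol] <;> field_simp
      linear_combination -hD
  · refine ⟨_, ⟨Units.mk0 (A 0 0 ^ 2 / -D) (div_ne_zero (pow_ne_zero 2 ha) (neg_ne_zero.mpr hD0)),
      .inr rfl⟩, _, .inl (.inr ⟨_, A 0 1 / A 0 0, hΩ, div_ne_zero hb ha, fun h => hd ?_, rfl⟩),
      mobius_eq_of_smul (c := -D / A 0 0) (div_ne_zero (neg_ne_zero.mpr hD0) ha) fun i j => ?_⟩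
    · field_simp at h
      have : A 0 0 * A 1 1 = 0 := by linear_combination h + hD
      exact (mul_eq_zero.mp this).resolve_left ha
    · fin_cases i <;> fin_cases j <;> simp [coe_trans, coe_scale, coe_invol] <;> field_simp
      linear_combination hD

/-- Every Möbius transformation lies in the right coset of an element of the transversal. -/
theorem exists_factorization (k : Kind) (A : GL (Fin 2) ℂ) :
    ∃ h ∈ k.subgroup, ∃ τ ∈ k.transversal, mobius A = mobius (h * τ) := by
  cases k
  · exact exists_factorization_e A
  · exact exists_factorization_l A

/-- The cosets of `H₀` and of `H₁` are represented at most once: left multiplication by `H₀`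
preserves the bottom row of a matrix and changes the top row by a sign and a multiple of the bottom
row, and left multiplication by `H₁` rescales the two rows and possibly swaps them. -/
theorem transversal_unique (k : Kind) {h h' τ τ' : GL (Fin 2) ℂ} (hh : h ∈ k.subgroup)
    (hh' : h' ∈ k.subgroup) (hτ : τ ∈ k.transversal) (hτ' : τ' ∈ k.transversal)
    (heq : mobius (h * τ) = mobius (h' * τ')) : τ = τ' := by
  obtain ⟨c, hc, hij⟩ := exists_smul_of_mobius_eq heq
  have h00 := hij 0 0
  have h01 := hij 0 1
  have h10 := hij 1 0
  have h11 := hij 1 1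
  clear hij heq
  simp only [Units.val_mul, Matrix.mul_apply, Fin.sum_univ_two] at h00 h01 h10 h11
  cases k
  · have key : ∀ h ∈ Kind.e.subgroup, h 1 0 = 0 ∧ h 1 1 = 1 ∧ (h 0 0 = 1 ∨ h 0 0 = -1) := by
      rintro _ ⟨a, rfl | rfl⟩ <;> simp [coe_trans, coe_scale]
    obtain ⟨h1, h2, h3⟩ := key h hh
    obtain ⟨h1', h2', h3'⟩ := key h' hh'
    rw [h1, h2, h1', h2'] at h10 h11
    generalize h 0 0 = ε at *
    generalize h 0 1 = a at *
    generalize h' 0 0 = ε' at *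
    generalize h' 0 1 = a' at *
    have hsign : ∀ {ρ ρ' : ℂˣ}, (ρ : ℂ) ∈ Omega → (ρ' : ℂ) ∈ Omega → ε * (ρ : ℂ) = ε' * (ρ' : ℂ) →
        ρ = ρ' := by
      intro ρ ρ' hρ hρ' hmul
      by_contra hne
      have hneg : (ρ' : ℂ) = -ρ := by
        rcases h3 with rfl | rfl <;> rcases h3' with rfl | rfl <;>
          first
          | exact absurd (Units.ext (by linear_combination hmul)) hne
          | exact absurd (Units.ext (by linear_combination -hmul)) hne
          | linear_combination hmul
          | linear_combination -hmul
      exact neg_notMem_Omega hρ (hneg ▸ hρ')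
    rcases hτ with ⟨ρ, hρ, rfl⟩ | ⟨ρ, b, hρ, rfl⟩ <;>
      rcases hτ' with ⟨ρ', hρ', rfl⟩ | ⟨ρ', b', hρ', rfl⟩ <;>
      simp [coe_trans, coe_scale, coe_invol] at h00 h01 h10 h11
    · subst h11
      rw [hsign hρ hρ' (by linear_combination h00)]
    · exact absurd h10.symm hc
    · subst h10
      have : b = b' := by linear_combination h11
      subst this
      rw [hsign hρ hρ' (by linear_combination h01 - b * h00)]
  · have key : ∀ h ∈ Kind.l.subgroup, (∃ α : ℂ, α ≠ 0 ∧ h 0 0 = α ∧ h 0 1 = 0 ∧ h 1 0 = 0 ∧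
        h 1 1 = 1) ∨ (∃ α : ℂ, α ≠ 0 ∧ h 0 0 = 0 ∧ h 0 1 = α ∧ h 1 0 = 1 ∧ h 1 1 = 0) := by
      rintro _ ⟨α, rfl | rfl⟩
      · exact .inl ⟨α, α.ne_zero, by simp [coe_scale]⟩
      · exact .inr ⟨α, α.ne_zero, by simp [coe_scale, coe_invol]⟩
    have hrows : ∃ u v : ℂ, u ≠ 0 ∧ v ≠ 0 ∧
        ((τ 0 0 = u * τ' 0 0 ∧ τ 0 1 = u * τ' 0 1 ∧ τ 1 0 = v * τ' 1 0 ∧ τ 1 1 = v * τ' 1 1) ∨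
          (τ 0 0 = u * τ' 1 0 ∧ τ 0 1 = u * τ' 1 1 ∧ τ 1 0 = v * τ' 0 0 ∧
            τ 1 1 = v * τ' 0 1)) := by
      rcases key h hh with ⟨α, hα, e1, e2, e3, e4⟩ | ⟨α, hα, e1, e2, e3, e4⟩ <;>
        rcases key h' hh' with ⟨β, hβ, e1', e2', e3', e4'⟩ | ⟨β, hβ, e1', e2', e3', e4'⟩ <;>
        rw [e1, e2, e1', e2'] at h00 h01 <;> rw [e3, e4, e3', e4'] at h10 h11
      · refine ⟨c * β / α, c, div_ne_zero (mul_ne_zero hc hβ) hα, hc, .inl ⟨?_, ?_, ?_, ?_⟩⟩ <;>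
          field_simp <;> grind
      · refine ⟨c * β / α, c, div_ne_zero (mul_ne_zero hc hβ) hα, hc, .inr ⟨?_, ?_, ?_, ?_⟩⟩ <;>
          field_simp <;> grind
      · refine ⟨c, c * β / α, hc, div_ne_zero (mul_ne_zero hc hβ) hα, .inr ⟨?_, ?_, ?_, ?_⟩⟩ <;>
          field_simp <;> grind
      · refine ⟨c, c * β / α, hc, div_ne_zero (mul_ne_zero hc hβ) hα, .inl ⟨?_, ?_, ?_, ?_⟩⟩ <;>
          field_simp <;> grind
    clear key h00 h01 h10 h11
    obtain ⟨u, v, hu, hv, hrows⟩ := hrows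
    rcases hτ with (⟨b, rfl⟩ | ⟨a, b, ha, hb, hab, rfl⟩) | ⟨d, hd, rfl⟩ <;>
      rcases hτ' with (⟨b', rfl⟩ | ⟨a', b', ha', hb', hab', rfl⟩) | ⟨d', hd', rfl⟩ <;>
      simp [coe_trans, coe_invol] at hrows
    · rw [show b = b' by grind]
    · have := ne_zero_of_mem_Omega ha'
      grind
    · grind
    · have := ne_zero_of_mem_Omega ha
      grind
    · have h0 := ne_zero_of_mem_Omega ha'
      rcases hrows with ⟨e1, e2, e3, e4⟩ | ⟨e1, e2, e3, e4⟩
      · obtain rfl : b = b' := by rw [e4, ← e3, one_mul]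
        rw [show a = a' by grind]
      · -- Swapping the zero and the pole changes the sign of the first parameter.
        have hneg : a' = -a := by grind
        exact absurd (hneg ▸ ha') (neg_notMem_Omega ha)
    · have := ne_zero_of_mem_Omega ha
      grind
    · grind
    · have := ne_zero_of_mem_Omega ha'
      grind
    · rw [show d = d' by grind]

/-! ### Germs of Möbius transformations -/

theorem mobius_one : mobius 1 = (fun z => z : P1 → P1) := funext fun z => one_smul _ z

namespace MobiusGerm

theorem exists_eq_mk {p q : P1} (f : MobiusGerm p q) : ∃ A, ∃ h : mobius A p = q, f = mk A h := by
  obtain ⟨φ, A, h, rfl⟩ := f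
  exact ⟨A, h, rfl⟩

theorem mk_comp_mk {p q r : P1} {A B : GL (Fin 2) ℂ} (hA : mobius A p = q) (hB : mobius B q = r) :
    (mk A hA).comp (mk B hB) = mk (B * A) (by rw [mobius_mul, hA, hB]) := by
  subst hA
  exact Subtype.ext (congrArg Germ.ofFun (funext fun z => (mobius_mul B A z).symm))

theorem mobius_apply_of_val_eq {p q : P1} {f : MobiusGerm p q} {A : GL (Fin 2) ℂ}
    (h : f.1 = (mobius A : Germ (𝓝 p) P1)) : mobius A p = q := by
  obtain ⟨B, hB, rfl⟩ := f.exists_eq_mk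
  rw [← mobius_eq_of_germ_eq (A := B) (B := A) h, hB]

theorem eq_mk {p q : P1} {f : MobiusGerm p q} {A : GL (Fin 2) ℂ}
    (h : f.1 = (mobius A : Germ (𝓝 p) P1)) : f = mk A (mobius_apply_of_val_eq h) :=
  Subtype.ext h

theorem mk_congr {p q : P1} {A B : GL (Fin 2) ℂ} (hA : mobius A p = q) (h : mobius A = mobius B) :
    mk A hA = mk B (h ▸ hA) :=
  Subtype.ext (congrArg Germ.ofFun h)

theorem comp_assoc {p q r s : P1} (f : MobiusGerm p q) (g : MobiusGerm q r) (h : MobiusGerm r s) :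
    (f.comp g).comp h = f.comp (g.comp h) :=
  mobiusGroupoid.assoc f g h

theorem comp_one {p q : P1} (f : MobiusGerm p q) : f.comp (mk 1 (one_smul _ q)) = f :=
  mobiusGroupoid.comp_id f

theorem one_comp {p q : P1} (f : MobiusGerm p q) : (mk 1 (one_smul _ p)).comp f = f :=
  mobiusGroupoid.id_comp f

theorem comp_left_cancel {p q r : P1} {f : MobiusGerm p q} {g h : MobiusGerm q r}
    (H : f.comp g = f.comp h) : g = h := by
  rw [← one_comp g, ← one_comp h, ← symm_comp f, comp_assoc, H, comp_assoc]

end MobiusGerm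

open MobiusGerm

/-! ### Conjugation of germs by the exponential -/

/-- The scaling `z ↦ exp (a) z`. -/
noncomputable def scaleExp (a : ℂ) : GL (Fin 2) ℂ :=
  scale (Units.mk0 (Complex.exp a) (Complex.exp_ne_zero a))

theorem coe_scaleExp (a : ℂ) :
    (scaleExp a : Matrix (Fin 2) (Fin 2) ℂ) = !![Complex.exp a, 0; 0, 1] := rfl

theorem scaleExp_zero : scaleExp 0 = 1 := by
  ext i j; fin_cases i <;> fin_cases j <;> simp [coe_scaleExp]

/-- The symbol inverse to a given one. -/
def Kind.bar : Kind → Kind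
  | .e => .l
  | .l => .e

@[simp] theorem Kind.bar_bar (k : Kind) : k.bar.bar = k := by cases k <;> rfl

theorem Kind.bar_ne (k : Kind) : k.bar ≠ k := by cases k <;> simp [Kind.bar]

theorem Kind.eq_bar_of_ne {k k' : Kind} (h : k' ≠ k) : k' = k.bar := by
  cases k <;> cases k' <;> simp_all [Kind.bar]

/-- There is a germ of `exp` (resp. of some branch of `log`, not necessarily the principal one)
from `p` to `q`. -/
def Kind.Edge : Kind → P1 → P1 → Prop
  | .e, p, q => ∃ z : ℂ, p = z ∧ q = (Complex.exp z : ℂ)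
  | .l, p, q => ∃ z : ℂ, q = z ∧ p = (Complex.exp z : ℂ)

theorem Kind.Edge.bar {k : Kind} {p q : P1} (h : k.Edge p q) : k.bar.Edge q p := by
  cases k <;> exact h

theorem Kind.Joins.toEdge {k : Kind} {p q : P1} (h : k.Joins p q) : k.Edge p q := by
  cases k
  · exact h
  · obtain ⟨u, hu, rfl, rfl⟩ := h
    exact ⟨_, rfl, by rw [Complex.exp_log hu]⟩

theorem Kind.Joins.target_unique {k : Kind} {p q q' : P1} (h : k.Joins p q) (h' : k.Joins p q') :
    q = q' := by
  cases k
  · obtain ⟨z, rfl, rfl⟩ := h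
    obtain ⟨z', hz, rfl⟩ := h'
    rw [OnePoint.coe_injective hz]
  · obtain ⟨z, _, rfl, rfl⟩ := h
    obtain ⟨z', _, hz, rfl⟩ := h'
    rw [OnePoint.coe_injective hz]

/-- `h' = exp ∘ h ∘ exp⁻¹` for germs `h : z → z'` of an element of `H₀` and `h'` of an element of
`H₁`: either `h = t_a` and `h' = s_{exp a}`, or `h = t_a s_{-1}` and `h' = s_{exp a} w`. -/
def ExpConj {v v' y y' : P1} (h : MobiusGerm v v') (h' : MobiusGerm y y') : Prop :=
  (∃ z : ℂ, v = z ∧ y = (Complex.exp z : ℂ)) ∧ (∃ z : ℂ, v' = z ∧ y' = (Complex.exp z : ℂ)) ∧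
    ∃ a : ℂ,
      (h.1 = (mobius (trans a) : Germ (𝓝 v) P1) ∧ h'.1 = (mobius (scaleExp a) : Germ (𝓝 y) P1)) ∨
      (h.1 = (mobius (trans a * scale (-1)) : Germ (𝓝 v) P1) ∧
        h'.1 = (mobius (scaleExp a * invol) : Germ (𝓝 y) P1))

/-- `h'` is the conjugate of `h` by the germs of `exp`, resp. by those of the branches of `log`. -/
def Conj (k : Kind) {v v' y y' : P1} (h : MobiusGerm v v') (h' : MobiusGerm y y') : Prop :=
  match k with
  | .e => ExpConj h h'
  | .l => ExpConj h' h

theorem mobius_trans_scale_neg (a z : ℂ) :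
    mobius (trans a * scale (-1)) (z : P1) = ((-z + a : ℂ) : P1) := by
  rw [mobius_mul, mobius_scale, mobius_trans]
  simp

theorem mobius_scale_invol (α : ℂˣ) {z : ℂ} (hz : z ≠ 0) :
    mobius (scale α * invol) (z : P1) = ((α * z⁻¹ : ℂ) : P1) := by
  rw [mobius_mul, mobius_invol hz, mobius_scale]

namespace Conj

variable {k : Kind} {v v' v'' y y' y'' : P1}

theorem bar {h : MobiusGerm v v'} {h' : MobiusGerm y y'} (H : Conj k h h') :
    Conj k.bar h' h := by
  cases k <;> exact H

theorem source {h : MobiusGerm v v'} {h' : MobiusGerm y y'} (H : Conj k h h') : k.Edge v y := by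
  cases k <;> exact H.1

theorem target {h : MobiusGerm v v'} {h' : MobiusGerm y y'} (H : Conj k h h') : k.Edge v' y' := by
  cases k <;> exact H.2.1

theorem exists_mem_subgroup {h : MobiusGerm v v'} {h' : MobiusGerm y y'} (H : Conj k h h') :
    ∃ A ∈ k.subgroup, h.1 = (mobius A : Germ (𝓝 v) P1) := by
  cases k
  · obtain ⟨-, -, a, ⟨e, -⟩ | ⟨e, -⟩⟩ := H
    · exact ⟨_, ⟨a, .inl rfl⟩, e⟩
    · exact ⟨_, ⟨a, .inr rfl⟩, e⟩
  · obtain ⟨-, -, a, ⟨-, e⟩ | ⟨-, e⟩⟩ := H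
    · exact ⟨_, ⟨_, .inl rfl⟩, e⟩
    · exact ⟨_, ⟨_, .inr rfl⟩, e⟩

end Conj

theorem ExpConj.one {v y : P1} (E : ∃ z : ℂ, v = z ∧ y = (Complex.exp z : ℂ)) :
    ExpConj (MobiusGerm.mk 1 (one_smul _ v)) (MobiusGerm.mk 1 (one_smul _ y)) := by
  refine ⟨E, E, 0, .inl ⟨?_, ?_⟩⟩
  · rw [trans_zero]; rfl
  · rw [scaleExp_zero]; rfl

theorem comp_val {p q r : P1} {f : MobiusGerm p q} {g : MobiusGerm q r} {A B C : GL (Fin 2) ℂ}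
    (hf : f.1 = (mobius A : Germ (𝓝 p) P1)) (hg : g.1 = (mobius B : Germ (𝓝 q) P1))
    (hC : mobius (B * A) = mobius C) : (f.comp g).1 = (mobius C : Germ (𝓝 p) P1) := by
  rw [eq_mk hf, eq_mk hg, mk_comp_mk, ← hC]
  rfl

theorem ExpConj.comp {v v' v'' y y' y'' : P1} {h : MobiusGerm v v'} {h' : MobiusGerm y y'}
    {g : MobiusGerm v' v''} {g' : MobiusGerm y' y''} (H : ExpConj h h') (G : ExpConj g g') :
    ExpConj (h.comp g) (h'.comp g') := by
  obtain ⟨E, -, a, H⟩ := H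
  obtain ⟨-, E', b, G⟩ := G
  rcases H with ⟨e, e'⟩ | ⟨e, e'⟩ <;> rcases G with ⟨f, f'⟩ | ⟨f, f'⟩
  · refine ⟨E, E', b + a, .inl ⟨comp_val e f (congrArg _ ?_), comp_val e' f' (congrArg _ ?_)⟩⟩ <;>
      ext i j <;> fin_cases i <;> fin_cases j <;> simp [coe_trans, coe_scaleExp, Complex.exp_add]
    ring
  · refine ⟨E, E', b - a, .inr ⟨comp_val e f (congrArg _ ?_), comp_val e' f'
      (mobius_eq_of_smul (Complex.exp_ne_zero a) fun i j => ?_)⟩⟩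
    · ext i j; fin_cases i <;> fin_cases j <;> simp [coe_trans, coe_scale]
      ring
    · fin_cases i <;> fin_cases j <;> simp [coe_invol, coe_scaleExp, Complex.exp_sub]
      field_simp
  · refine ⟨E, E', b + a, .inr ⟨comp_val e f (congrArg _ ?_), comp_val e' f' (congrArg _ ?_)⟩⟩ <;>
      ext i j <;> fin_cases i <;> fin_cases j <;>
      simp [coe_trans, coe_scale, coe_invol, coe_scaleExp, Complex.exp_add]
    ring
  · refine ⟨E, E', b - a, .inl ⟨comp_val e f (congrArg _ ?_), comp_val e' f'
      (mobius_eq_of_smul (Complex.exp_ne_zero a) fun i j => ?_)⟩⟩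
    · ext i j; fin_cases i <;> fin_cases j <;> simp [coe_trans, coe_scale]
      ring
    · fin_cases i <;> fin_cases j <;> simp [coe_invol, coe_scaleExp, Complex.exp_sub]
      field_simp

/-- A germ of an element of `H₀` at a finite point determines its conjugate. -/
theorem ExpConj.right_unique {v v' y y' : P1} {h : MobiusGerm v v'} {g g' : MobiusGerm y y'}
    (G : ExpConj h g) (G' : ExpConj h g') : g = g' := by
  obtain ⟨-, -, a, ⟨e, f⟩ | ⟨e, f⟩⟩ := G <;> obtain ⟨-, -, a', ⟨e', f'⟩ | ⟨e', f'⟩⟩ := G' <;>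
    obtain ⟨c, hc, hij⟩ := exists_smul_of_germ_eq (e.symm.trans e') <;>
    have h00 := hij 0 0 <;> have h01 := hij 0 1 <;> have h11 := hij 1 1 <;>
    simp [coe_trans, coe_scale] at h00 h01 h11
  · rw [h01, ← h00, one_mul] at f
    exact Subtype.ext (f.trans f'.symm)
  · grind
  · grind
  · rw [h01, ← h00, one_mul] at f
    exact Subtype.ext (f.trans f'.symm)

/-- A germ of an element of `H₁` at a finite nonzero point determines its conjugate by given
branches of the logarithm: the exponential of the translation part is known, and so is the value of
the conjugate at one point. -/
theorem ExpConj.left_unique {v v' y y' : P1} {h : MobiusGerm v v'} {g g' : MobiusGerm y y'}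
    (G : ExpConj g h) (G' : ExpConj g' h) : g = g' := by
  obtain ⟨⟨z, rfl, rfl⟩, ⟨z', rfl, rfl⟩, a, G⟩ := G
  obtain ⟨-, -, a', G'⟩ := G'
  rcases G with ⟨e, f⟩ | ⟨e, f⟩ <;> rcases G' with ⟨e', f'⟩ | ⟨e', f'⟩
  · have h1 := mobius_apply_of_val_eq e
    have h2 := mobius_apply_of_val_eq e'
    rw [mobius_trans] at h1 h2
    rw [add_left_cancel (OnePoint.coe_injective (h1.trans h2.symm))] at e
    exact Subtype.ext (e.trans e'.symm)
  · obtain ⟨c, hc, hij⟩ := exists_smul_of_germ_eq (f.symm.trans f')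
    exact absurd (hij 0 0) (by simp [coe_scaleExp, coe_invol])
  · obtain ⟨c, hc, hij⟩ := exists_smul_of_germ_eq (f'.symm.trans f)
    exact absurd (hij 0 0) (by simp [coe_scaleExp, coe_invol])
  · have h1 := mobius_apply_of_val_eq e
    have h2 := mobius_apply_of_val_eq e'
    rw [mobius_trans_scale_neg] at h1 h2
    rw [add_left_cancel (OnePoint.coe_injective (h1.trans h2.symm))] at e
    exact Subtype.ext (e.trans e'.symm)

namespace Conj

variable {k : Kind} {v v' v'' y y' y'' : P1}

theorem one (E : k.Edge v y) :
    Conj k (MobiusGerm.mk 1 (one_smul _ v)) (MobiusGerm.mk 1 (one_smul _ y)) := by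
  cases k <;> exact ExpConj.one E

theorem comp {h : MobiusGerm v v'} {h' : MobiusGerm y y'}
    {g : MobiusGerm v' v''} {g' : MobiusGerm y' y''} (H : Conj k h h') (G : Conj k g g') :
    Conj k (h.comp g) (h'.comp g') := by
  cases k <;> exact ExpConj.comp H G

theorem unique {h : MobiusGerm v v'} {g g' : MobiusGerm y y'} (G : Conj k h g)
    (G' : Conj k h g') : g = g' := by
  cases k
  · exact ExpConj.right_unique G G'
  · exact ExpConj.left_unique G G'

/-- Germs of elements of the subgroup attached to `k` can be conjugated by `k`. -/
theorem exists_of_mem_subgroup {h : MobiusGerm v v'} {A : GL (Fin 2) ℂ} (hA : A ∈ k.subgroup)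
    (hh : h.1 = (mobius A : Germ (𝓝 v) P1)) (E : k.Edge v y) (E' : k.Edge v' y') :
    ∃ h' : MobiusGerm y y', Conj k h h' := by
  have hpt := mobius_apply_of_val_eq hh
  cases k
  · obtain ⟨z, rfl, rfl⟩ := E
    obtain ⟨z', rfl, rfl⟩ := E'
    obtain ⟨a, rfl | rfl⟩ := hA
    · rw [mobius_trans] at hpt
      refine ⟨MobiusGerm.mk (scaleExp a) ?_, ⟨z, rfl, rfl⟩, ⟨z', rfl, rfl⟩, a, .inl ⟨hh, rfl⟩⟩
      rw [scaleExp, mobius_scale, Units.val_mk0, ← Complex.exp_add, ← OnePoint.coe_injective hpt,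
        add_comm]
    · rw [mobius_trans_scale_neg] at hpt
      refine ⟨MobiusGerm.mk (scaleExp a * invol) ?_, ⟨z, rfl, rfl⟩, ⟨z', rfl, rfl⟩, a,
        .inr ⟨hh, rfl⟩⟩
      rw [scaleExp, mobius_scale_invol _ (Complex.exp_ne_zero z), Units.val_mk0, ← Complex.exp_neg,
        ← Complex.exp_add, ← OnePoint.coe_injective hpt, add_comm]
  · obtain ⟨z, rfl, rfl⟩ := E
    obtain ⟨z', rfl, rfl⟩ := E'
    obtain ⟨α, rfl | rfl⟩ := hA
    · rw [mobius_scale] at hpt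
      have hα : scale α = scaleExp (z' - z) := by
        refine congrArg scale (Units.ext ?_)
        rw [Units.val_mk0, Complex.exp_sub, ← OnePoint.coe_injective hpt,
          mul_div_cancel_right₀ _ (Complex.exp_ne_zero z)]
      refine ⟨MobiusGerm.mk (trans (z' - z)) ?_, ⟨z, rfl, rfl⟩, ⟨z', rfl, rfl⟩, z' - z,
        .inl ⟨rfl, by rw [hh, hα]⟩⟩
      rw [mobius_trans, add_sub_cancel]
    · rw [mobius_scale_invol _ (Complex.exp_ne_zero z)] at hpt
      have hα : scale α = scaleExp (z' + z) := by
        refine congrArg scale (Units.ext ?_)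
        rw [Units.val_mk0, Complex.exp_add, ← OnePoint.coe_injective hpt,
          inv_mul_cancel_right₀ (Complex.exp_ne_zero z)]
      refine ⟨MobiusGerm.mk (trans (z' + z) * scale (-1)) ?_, ⟨z, rfl, rfl⟩, ⟨z', rfl, rfl⟩, z' + z,
        .inr ⟨rfl, by rw [hh, hα]⟩⟩
      rw [mobius_trans_scale_neg, show -z + (z' + z) = z' by ring]

end Conj

/-- The subgroup attached to `k` preserves the set of points where `k` has germs. -/
theorem exists_joins_of_mem_subgroup {k : Kind} {A : GL (Fin 2) ℂ} (hA : A ∈ k.subgroup)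
    {p q : P1} (h : k.Edge (mobius A p) q) : ∃ r, k.Joins p r := by
  cases k
  · obtain ⟨z, hz, -⟩ := h
    induction p using OnePoint.rec with
    | coe u => exact ⟨_, u, rfl, rfl⟩
    | infty =>
      obtain ⟨a, rfl | rfl⟩ := hA <;>
        simp [mobius, OnePoint.smul_infty_eq_ite, coe_trans, coe_scale] at hz
  · obtain ⟨z, -, hz⟩ := h
    induction p using OnePoint.rec with
    | coe u =>
      by_cases hu : u = 0
      · subst hu
        obtain ⟨a, rfl | rfl⟩ := hA <;>
          simp [mobius, OnePoint.smul_some_eq_ite, coe_scale, coe_invol] at hz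
        exact absurd hz.symm (Complex.exp_ne_zero z)
      · exact ⟨_, u, hu, rfl, rfl⟩
    | infty =>
      obtain ⟨a, rfl | rfl⟩ := hA <;>
        simp [mobius, OnePoint.smul_infty_eq_ite, coe_scale, coe_invol] at hz
      exact absurd hz.symm (Complex.exp_ne_zero z)

/-! ### Uniqueness of the factorization for germs -/

theorem germ_factorization_unique {k : Kind} {u p p' q : P1} {τ : MobiusGerm u p}
    {h : MobiusGerm p q} {τ' : MobiusGerm u p'} {h' : MobiusGerm p' q}
    (hτ : ∃ A ∈ k.transversal, τ.1 = (mobius A : Germ (𝓝 u) P1))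
    (hh : ∃ A ∈ k.subgroup, h.1 = (mobius A : Germ (𝓝 p) P1))
    (hτ' : ∃ A ∈ k.transversal, τ'.1 = (mobius A : Germ (𝓝 u) P1))
    (hh' : ∃ A ∈ k.subgroup, h'.1 = (mobius A : Germ (𝓝 p') P1))
    (H : τ.comp h = τ'.comp h') : p = p' ∧ τ ≍ τ' ∧ h ≍ h' := by
  obtain ⟨A, hA, eA⟩ := hτ
  obtain ⟨B, hB, eB⟩ := hh
  obtain ⟨A', hA', eA'⟩ := hτ'
  obtain ⟨B', hB', eB'⟩ := hh'
  have hAA : A = A' := by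
    refine transversal_unique k hB hB' hA hA' (mobius_eq_of_germ_eq (p := u) ?_)
    rw [← comp_val eA eB rfl, ← comp_val eA' eB' rfl, H]
  subst hAA
  obtain rfl : p = p' := (mobius_apply_of_val_eq eA).symm.trans (mobius_apply_of_val_eq eA')
  obtain rfl : τ = τ' := Subtype.ext (eA.trans eA'.symm)
  exact ⟨rfl, HEq.rfl, heq_of_eq (comp_left_cancel H)⟩

theorem Tail.isNormal_cons {x u v y : P1} {k : Kind} {h : k.Joins v y} {g : MobiusGerm u v}
    {p : Tail x u} : (Tail.cons k h g p).IsNormal ↔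
      (∃ A ∈ k.transversal, g.1 = (mobius A : Germ (𝓝 u) P1)) ∧
        (g.1 = ((fun z => z : P1 → P1) : Germ (𝓝 u) P1) → p.HeadIs k) ∧ p.IsNormal := by
  rw [Tail.IsNormal]

/-! ### The action of the generators on normal forms -/

namespace NormalForm

/-- The action of a Möbius germ on normal forms, by multiplication on the left. -/
noncomputable def mul {x y z : P1} (a : NormalForm x y) (g : MobiusGerm y z) : NormalForm x z :=
  ⟨a.g₀.comp g, a.tail, a.isNormal⟩

theorem mul_comp {x y z w : P1} (a : NormalForm x y) (g : MobiusGerm y z) (h : MobiusGerm z w) :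
    a.mul (g.comp h) = (a.mul g).mul h := by
  simp only [mul, comp_assoc]

theorem mul_one {x y : P1} (a : NormalForm x y) : a.mul (MobiusGerm.mk 1 (one_smul _ y)) = a := by
  simp only [mul, comp_one]

/-- Multiplication of the normal form `a` by a germ `k` without cancellation: the first entry
`g₀ = h τ` of `a` is factored with `τ` in the transversal, and `k h τ = h' k τ` where `h'` is the
conjugate of `h`. Multiplication by a germ that cancels the first symbol of `a` is the same relation
with the two normal forms exchanged and `k` replaced by its inverse. -/
def Push (k : Kind) {x v y : P1} (a : NormalForm x v) (b : NormalForm x y) : Prop :=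
  ∃ (v₀ y₀ : P1) (J : k.Joins v₀ y₀) (τ : MobiusGerm a.mid v₀) (h : MobiusGerm v₀ v)
    (h' : MobiusGerm y₀ y) (hn : (Tail.cons k J τ a.tail).IsNormal),
    a.g₀ = τ.comp h ∧ Conj k h h' ∧ b = ⟨h', Tail.cons k J τ a.tail, hn⟩

theorem Push.mul {k : Kind} {x v v' y y' : P1} {a : NormalForm x v} {b : NormalForm x y}
    (H : Push k a b) {g : MobiusGerm v v'} {g' : MobiusGerm y y'} (G : Conj k g g') :
    Push k (a.mul g) (b.mul g') := by
  obtain ⟨v₀, y₀, J, τ, h, h', hn, hg, hc, rfl⟩ := H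
  exact ⟨v₀, y₀, J, τ, h.comp g, h'.comp g', hn,
    (congrArg (·.comp g) hg).trans (comp_assoc τ h g), hc.comp G, rfl⟩

theorem Push.right_unique {k : Kind} {x v y : P1} {a : NormalForm x v} {b b' : NormalForm x y}
    (H : Push k a b) (H' : Push k a b') : b = b' := by
  obtain ⟨v₀, y₀, J, τ, h, h', hn, hg, hc, rfl⟩ := H
  obtain ⟨w₀, z₀, K, σ, i, i', hn', hg', hc', rfl⟩ := H'
  obtain ⟨rfl, hσ, hi⟩ := germ_factorization_unique (Tail.isNormal_cons.mp hn).1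
    hc.exists_mem_subgroup (Tail.isNormal_cons.mp hn').1 hc'.exists_mem_subgroup (hg.symm.trans hg')
  obtain rfl := eq_of_heq hσ
  obtain rfl := eq_of_heq hi
  obtain rfl := J.target_unique K
  obtain rfl := hc.unique hc'
  rfl

/-- The cancellation of a symbol is unambiguous: the cancelled tail determines all the data but the
conjugate of the first entry. -/
theorem Push.left_unique {k : Kind} {x v y : P1} {a a' : NormalForm x v} {b : NormalForm x y}
    (H : Push k a b) (H' : Push k a' b) : a = a' := by
  obtain ⟨g, t, ht⟩ := a
  obtain ⟨g', t', ht'⟩ := a'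
  obtain ⟨v₀, y₀, J, τ, h, h', hn, hg, hc, rfl⟩ := H
  obtain ⟨w₀, z₀, K, σ, i, i', hn', hg', hc', hb⟩ := H'
  dsimp only at *
  cases hb
  obtain rfl := hc.bar.unique hc'.bar
  obtain rfl := hg.trans hg'.symm
  rfl

/-- A germ cannot both be pushed through a normal form and cancel its first symbol. -/
theorem Push.not_push_bar {k : Kind} {x v y y' : P1} {a : NormalForm x v} {b : NormalForm x y}
    {b' : NormalForm x y'} (H : Push k a b) (H' : Push k.bar b' a) : False := by
  obtain ⟨w₀, z₀, K, σ, i, i', hn', hg', hc', rfl⟩ := H'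
  obtain ⟨v₀, y₀, J, τ, h, h', hn, hg, hc, rfl⟩ := H
  dsimp only at *
  have hi := hc'.bar.exists_mem_subgroup
  rw [Kind.bar_bar] at hi
  -- Since `i' = τ h` belongs to the subgroup, its coset representative `τ` is the identity.
  obtain ⟨rfl, hτ, -⟩ := germ_factorization_unique (Tail.isNormal_cons.mp hn).1
    hc.exists_mem_subgroup ⟨1, one_mem_transversal k, rfl⟩ hi (hg.symm.trans (one_comp i').symm)
  obtain rfl := eq_of_heq hτ
  exact k.bar_ne ((Tail.isNormal_cons.mp hn).2.1 (congrArg Germ.ofFun mobius_one))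

theorem exists_push {k : Kind} {x v y : P1} (a : NormalForm x v) (E : k.Edge v y) :
    ∃ b : NormalForm x y, Push k a b ∨ Push k.bar b a := by
  obtain @⟨m, g, t, ht⟩ := a
  obtain ⟨A, hA, rfl⟩ := g.exists_eq_mk
  obtain ⟨B, hB, T, hT, hAB⟩ := exists_factorization k A
  obtain rfl : mobius B (mobius T m) = v := by rw [← mobius_mul, ← hAB, hA]
  obtain ⟨y₀, J⟩ := exists_joins_of_mem_subgroup hB E
  by_cases hn : (Tail.cons k J (MobiusGerm.mk T rfl) t).IsNormal
  · obtain ⟨h', hc⟩ := Conj.exists_of_mem_subgroup (h := MobiusGerm.mk B rfl) hB rfl J.toEdge E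
    exact ⟨⟨h', _, hn⟩, .inl ⟨_, y₀, J, MobiusGerm.mk T rfl, MobiusGerm.mk B rfl, h', hn,
      by rw [mk_comp_mk]; exact mk_congr hA hAB, hc, rfl⟩⟩
  · -- The factorization cannot be pushed only if `τ = 1` and the first symbol is inverse to `k`.
    have hn' : ¬ ((mobius T : Germ (𝓝 m) P1) = ((fun z => z : P1 → P1) : Germ (𝓝 m) P1) →
        t.HeadIs k) := fun h => hn (Tail.isNormal_cons.mpr ⟨⟨T, hT, rfl⟩, h, ht⟩)
    obtain ⟨hT1, hk⟩ := Classical.not_imp.mp hn'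
    have hT1 : mobius T = mobius 1 := mobius_eq_of_germ_eq (p := m) (by rw [mobius_one]; exact hT1)
    have hAB' : mobius A = mobius B := by
      rw [hAB]; funext z; rw [mobius_mul, hT1, mobius_one]
    cases t with
    | nil => exact absurd trivial hk
    | cons k' K σ p =>
      obtain rfl := Kind.eq_bar_of_ne hk
      obtain ⟨h', hc⟩ := Conj.exists_of_mem_subgroup (k := k) (h := MobiusGerm.mk A hA) hB
        (congrArg Germ.ofFun hAB') (by simpa using K.toEdge.bar) E
      exact ⟨⟨σ.comp h', p, (Tail.isNormal_cons.mp ht).2.2⟩,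
        .inr ⟨_, _, K, σ, h', _, ht, rfl, hc.bar, rfl⟩⟩

/-- Multiplication of normal forms by a germ `k` (any branch if `k` is the logarithm), as a
relation: either `k` is pushed through the first entry of `a`, or it cancels the first symbol of
`a`. -/
def Step (k : Kind) {x v y : P1} (a : NormalForm x v) (b : NormalForm x y) : Prop :=
  Push k a b ∨ Push k.bar b a

theorem Step.bar {k : Kind} {x v y : P1} {a : NormalForm x v} {b : NormalForm x y}
    (H : Step k a b) : Step k.bar b a := by
  rcases H with H | H
  · exact .inr (by rwa [Kind.bar_bar])
  · exact .inl H

/-- The multiplication by `k` is compatible with the relations `k h = h' k`. -/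
theorem Step.mul {k : Kind} {x v v' y y' : P1} {a : NormalForm x v} {b : NormalForm x y}
    (H : Step k a b) {g : MobiusGerm v v'} {g' : MobiusGerm y y'} (G : Conj k g g') :
    Step k (a.mul g) (b.mul g') :=
  H.imp (fun H => H.mul G) fun H => H.mul G.bar

theorem Step.unique {k : Kind} {x v y : P1} {a : NormalForm x v} {b b' : NormalForm x y}
    (H : Step k a b) (H' : Step k a b') : b = b' := by
  rcases H with H | H <;> rcases H' with H' | H'
  · exact H.right_unique H'
  · exact (H.not_push_bar H').elim
  · exact (H'.not_push_bar H).elim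
  · exact H.left_unique H'

theorem existsUnique_step {k : Kind} {x v y : P1} (a : NormalForm x v) (E : k.Edge v y) :
    ∃! b : NormalForm x y, Step k a b := by
  obtain ⟨b, hb⟩ := a.exists_push E
  exact ⟨b, hb, fun b' hb' => hb'.unique hb⟩

/-- The bijection of normal forms given by a germ of `exp`. -/
noncomputable def stepEquiv (x : P1) {v y : P1} (E : Kind.e.Edge v y) :
    NormalForm x v ≃ NormalForm x y where
  toFun a := (a.existsUnique_step E).choose
  invFun b := (b.existsUnique_step E.bar).choose
  left_inv a := (existsUnique_step _ E.bar).choose_spec.1.unique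
    (existsUnique_step a E).choose_spec.1.bar
  right_inv b := (existsUnique_step _ E).choose_spec.1.unique
    (existsUnique_step b E.bar).choose_spec.1.bar

theorem step_stepEquiv {x v y : P1} (E : Kind.e.Edge v y) (a : NormalForm x v) :
    Step .e a (stepEquiv x E a) :=
  (a.existsUnique_step E).choose_spec.1

end NormalForm

/-! ### The action of the free product and of its quotient -/

/-- Every morphism of a free groupoid is a composite of generators and of their inverses. -/
theorem freeGroupoid_induction {V : Type} [Quiver.{0} V]
    (P : ∀ {a b : Quiver.FreeGroupoid V}, (a ⟶ b) → Prop)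
    (hid : ∀ a, P (𝟙 a)) (hof : ∀ {a b : V} (f : a ⟶ b), P ((Quiver.FreeGroupoid.of V).map f))
    (hinv : ∀ {a b} (f : a ⟶ b), P f → P (Groupoid.inv f))
    (hcomp : ∀ {a b c} (f : a ⟶ b) (g : b ⟶ c), P f → P g → P (f ≫ g))
    {a b : Quiver.FreeGroupoid V} (f : a ⟶ b) : P f := by
  have key : ∀ {a b : Quiver.Symmetrify V} (p : Quiver.Path a b),
      P (a := ⟨a⟩) (b := ⟨b⟩) (Quot.mk _ p) := by
    intro a b p
    induction p with
    | nil => exact hid _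
    | cons p f ih =>
      rcases f with f | f
      · exact hcomp _ _ ih (hof f)
      · exact hcomp _ _ ih (hinv _ (hof f))
  exact Quot.ind (fun p => key p) f

/-- The points of the sphere, as the objects of the groupoid in which a morphism from `y` to `z` is
a bijection between the normal forms with source `x` and target `y` and those with source `x` and
target `z`. An action of a groupoid on the normal forms with source `x` is a functor to it. -/
def NormalFormEquiv (_x : P1) : Type := P1

instance (x : P1) : Groupoid.{0} (NormalFormEquiv x) where
  Hom y z := NormalForm x y ≃ NormalForm x z
  id y := Equiv.refl (NormalForm x y)
  comp f g := f.trans g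
  inv f := f.symm
  inv_comp f := f.symm_trans_self
  comp_inv f := f.self_trans_symm

/-- The bijection of normal forms given by a Möbius germ. -/
noncomputable def mulEquiv (x : P1) {y z : P1} (g : MobiusGerm y z) :
    NormalForm x y ≃ NormalForm x z where
  toFun a := a.mul g
  invFun a := a.mul g.symm
  left_inv a := by dsimp only; rw [← NormalForm.mul_comp, comp_symm, NormalForm.mul_one]
  right_inv a := by dsimp only; rw [← NormalForm.mul_comp, symm_comp, NormalForm.mul_one]

/-- The action of the free groupoid on the germs of `exp`. -/
noncomputable def expAction (x : P1) : Quiver.FreeGroupoid ExpGraph ⥤ NormalFormEquiv x :=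
  Quiver.FreeGroupoid.lift
    { obj := fun p => p
      map := fun f => NormalForm.stepEquiv x f.2.1 }

/-- The action of the generators of the free product. -/
noncomputable def letterAction (x : P1) :
    Quiver.FreeGroupoid (JoinGraph mobiusGroupoid expGroupoid) ⥤ NormalFormEquiv x :=
  Quiver.FreeGroupoid.lift
    { obj := fun p => p
      map := fun {y z} f => Sum.rec (motive := fun _ => NormalForm x y ≃ NormalForm x z)
        (fun g => mulEquiv x g) (fun f => (expAction x).map f) f }

/-- The action of the free product on normal forms. -/
noncomputable def action (x : P1) : F ⥤ NormalFormEquiv x :=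
  CategoryTheory.Quotient.lift _ (letterAction x) (by
    rintro _ _ _ _ (⟨f, g⟩ | ⟨f, g⟩)
    · rw [Functor.map_comp]
      exact Equiv.ext fun a => a.mul_comp f g
    · rw [Functor.map_comp]
      exact (expAction x).map_comp f g)

/-- The bijection of normal forms given by a morphism of the free product. -/
noncomputable def act {x y z : P1} (f : F.of y ⟶ F.of z) : NormalForm x y ≃ NormalForm x z :=
  (action x).map f

theorem act_comp {x y z w : P1} (f : F.of y ⟶ F.of z) (g : F.of z ⟶ F.of w)
    (a : NormalForm x y) : act (f ≫ g) a = act g (act f a) :=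
  congrArg (fun e : NormalForm x y ≃ NormalForm x w => e a) ((action x).map_comp f g)

theorem act_id {x y : P1} (a : NormalForm x y) : act (𝟙 (F.of y)) a = a :=
  congrArg (fun e : NormalForm x y ≃ NormalForm x y => e a) ((action x).map_id (F.of y))

theorem act_inl {x y z : P1} (g : MobiusGerm y z) (a : NormalForm x y) :
    act (FreeProduct.inl mobiusGroupoid expGroupoid g) a = a.mul g := rfl

theorem step_act_inr_expEdge {x y z : P1} (h : Kind.e.Edge y z) (a : NormalForm x y) :
    a.Step .e (act (FreeProduct.inr mobiusGroupoid expGroupoid (expEdge h)) a) :=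
  NormalForm.step_stepEquiv h a

theorem inr_comp {y z w : P1} (f : expGroupoid.Hom y z) (g : expGroupoid.Hom z w) :
    FreeProduct.inr mobiusGroupoid expGroupoid f ≫ FreeProduct.inr mobiusGroupoid expGroupoid g =
      FreeProduct.inr mobiusGroupoid expGroupoid (expGroupoid.comp f g) := by
  exact ((CategoryTheory.Quotient.functor _).map_comp _ _).symm.trans
    (CategoryTheory.Quotient.sound _ (MulRel.right f g)).symm

theorem inl_comp {y z w : P1} (f : MobiusGerm y z) (g : MobiusGerm z w) :
    FreeProduct.inl mobiusGroupoid expGroupoid f ≫ FreeProduct.inl mobiusGroupoid expGroupoid g =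
      FreeProduct.inl mobiusGroupoid expGroupoid (f.comp g) := by
  exact ((CategoryTheory.Quotient.functor _).map_comp _ _).symm.trans <| Eq.symm <|
    CategoryTheory.Quotient.sound _ (MulRel.left (G := mobiusGroupoid) (H := expGroupoid) f g)

theorem inl_one (y : P1) :
    FreeProduct.inl mobiusGroupoid expGroupoid (MobiusGerm.mk 1 (one_smul _ y)) = 𝟙 (F.of y) := by
  rw [← cancel_epi (FreeProduct.inl mobiusGroupoid expGroupoid (MobiusGerm.mk 1 (one_smul _ y))),
    inl_comp, comp_one, Category.comp_id]

theorem inr_one (y : P1) :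
    FreeProduct.inr mobiusGroupoid expGroupoid (expGroupoid.id y) = 𝟙 (F.of y) := by
  rw [← cancel_epi (FreeProduct.inr mobiusGroupoid expGroupoid (expGroupoid.id y)),
    inr_comp, expGroupoid.comp_id, Category.comp_id]

theorem inr_inv {y z : P1} (f : expGroupoid.Hom y z) :
    FreeProduct.inr mobiusGroupoid expGroupoid (expGroupoid.inv f) =
      Groupoid.inv (FreeProduct.inr mobiusGroupoid expGroupoid f) := by
  rw [← cancel_epi (FreeProduct.inr mobiusGroupoid expGroupoid f), inr_comp, expGroupoid.comp_inv,
    Groupoid.comp_inv, inr_one]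

theorem inr_logEdge {p q : P1} (h : ∃ u : ℂ, u ≠ 0 ∧ p = u ∧ q = (Complex.log u : ℂ)) :
    FreeProduct.inr mobiusGroupoid expGroupoid (logEdge h) =
      Groupoid.inv (FreeProduct.inr mobiusGroupoid expGroupoid
        (expEdge (Kind.Joins.toEdge (k := .l) h).bar)) :=
  inr_inv _

theorem inr_edge_l {p q : P1} (h : Kind.l.Joins p q) :
    FreeProduct.inr mobiusGroupoid expGroupoid (Kind.l.edge h) =
      Groupoid.inv (FreeProduct.inr mobiusGroupoid expGroupoid (expEdge h.toEdge.bar)) :=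
  inr_inv _

theorem act_inv_eq_iff {x y z : P1} {f : F.of y ⟶ F.of z} {a : NormalForm x y}
    {b : NormalForm x z} : act (Groupoid.inv f) b = a ↔ act f a = b := by
  constructor
  · rintro rfl
    rw [← act_comp, Groupoid.inv_comp, act_id]
  · rintro rfl
    rw [← act_comp, Groupoid.comp_inv, act_id]

/-- Both sides of a conjugation relation act in the same way on normal forms. -/
theorem act_conj {x y z y' z' : P1} {h : MobiusGerm y z} {h' : MobiusGerm y' z'}
    (H : ExpConj h h') (a : NormalForm x y) :
    act (FreeProduct.inr mobiusGroupoid expGroupoid (expEdge H.2.1)) (a.mul h) =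
      (act (FreeProduct.inr mobiusGroupoid expGroupoid (expEdge H.1)) a).mul h' :=
  (step_act_inr_expEdge H.2.1 _).unique
    (NormalForm.Step.mul (k := .e) (step_act_inr_expEdge H.1 a) H)

theorem expConj_trans (a z : ℂ) : ExpConj (MobiusGerm.mk (trans a) (mobius_trans a z))
    (MobiusGerm.mk (p := (Complex.exp z : ℂ)) (q := (Complex.exp (z + a) : ℂ)) (scaleExp a)
      (by rw [scaleExp, mobius_scale, Units.val_mk0, Complex.exp_add, mul_comm])) :=
  ⟨⟨z, rfl, rfl⟩, ⟨z + a, rfl, rfl⟩, a, .inl ⟨rfl, rfl⟩⟩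

theorem expConj_neg (z : ℂ) :
    ExpConj (MobiusGerm.mk (p := z) (q := (-z : ℂ)) (scale (-1)) (by rw [mobius_scale]; simp))
      (MobiusGerm.mk (p := (Complex.exp z : ℂ)) (q := (Complex.exp (-z) : ℂ)) invol
        (by rw [mobius_invol (Complex.exp_ne_zero z), Complex.exp_neg])) := by
  refine ⟨⟨z, rfl, rfl⟩, ⟨-z, rfl, rfl⟩, 0, .inr ⟨?_, ?_⟩⟩
  · exact congrArg (fun A => (mobius A : Germ (𝓝 (z : P1)) P1)) (by rw [trans_zero, one_mul])
  · exact congrArg (fun A => (mobius A : Germ (𝓝 ((Complex.exp z : ℂ) : P1)) P1))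
      (by rw [scaleExp_zero, one_mul])

/-- Two logarithms of the same point differ by a translation which is conjugated to the identity. -/
theorem expConj_one_of_exp_eq {z z' : ℂ} {y : P1} (hy : y = (Complex.exp z : ℂ))
    (hy' : y = (Complex.exp z' : ℂ)) {g : MobiusGerm (z : P1) z'}
    (hg : g.1 = (mobius (trans (z' - z)) : Germ (𝓝 (z : P1)) P1)) :
    ExpConj g (MobiusGerm.mk 1 (one_smul _ y)) := by
  refine ⟨⟨z, rfl, hy⟩, ⟨z', rfl, hy'⟩, z' - z, .inl ⟨hg, ?_⟩⟩
  have h : Complex.exp (z' - z) = 1 := by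
    rw [Complex.exp_sub, OnePoint.coe_injective (hy'.symm.trans hy),
      div_self (Complex.exp_ne_zero z)]
  rw [show scaleExp (z' - z) = 1 by
    ext i j; fin_cases i <;> fin_cases j <;> simp [coe_scaleExp, h]]
  rfl

/-- The relations act trivially on normal forms. -/
theorem act_eq_of_relPair (x : P1) {c d : F} {u v : c ⟶ d} (h : RelPair u v) :
    (action x).map u = (action x).map v := by
  cases h with
  | log_exp r z hz =>
    refine Equiv.ext fun (a : NormalForm x z) => ?_
    have H := act_conj (expConj_one_of_exp_eq (z := z) (z' := Complex.log (Complex.exp z))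
      (y := (Complex.exp z : ℂ)) rfl (by rw [Complex.exp_log (Complex.exp_ne_zero z)])
      (g := MobiusGerm.mk (trans (-(2 * Real.pi * Complex.I * r)))
        (by rw [mobius_trans, log_exp_of_mem_strip hz]))
      (congrArg (fun b => (mobius (trans b) : Germ (𝓝 (z : P1)) P1))
        (by rw [log_exp_of_mem_strip hz, add_sub_cancel_left]))) a
    rw [NormalForm.mul_one] at H
    change act (F.e z ≫ F.l (Complex.exp z) (Complex.exp_ne_zero z)) a = act (F.mob _ _) a
    rw [act_comp, F.l, inr_logEdge, act_inv_eq_iff]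
    exact H
  | exp_neg z => exact Equiv.ext fun a => act_conj (expConj_neg z) a
  | exp_add a z => exact Equiv.ext fun b => act_conj (expConj_trans a z) b

theorem action_map_inv (x : P1) {c d : F} (f : c ⟶ d) :
    (action x).map (Groupoid.inv f) = Groupoid.inv ((action x).map f) := by
  rw [Groupoid.inv_eq_inv, Groupoid.inv_eq_inv, Functor.map_inv]

theorem action_eq_id_of_isConsequence (x : P1) {c : F} {n : c ⟶ c} (h : IsConsequence Rel c n) :
    (action x).map n = 𝟙 _ := by
  have hrel : ∀ {d : F} {ρ : d ⟶ d}, ρ ∈ Rel d → (action x).map ρ = 𝟙 _ := by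
    rintro d _ ⟨c, u, v, huv, rfl⟩
    rw [Functor.map_comp, act_eq_of_relPair x huv, ← Functor.map_comp, Groupoid.inv_comp,
      CategoryTheory.Functor.map_id]
  induction h with
  | id => exact CategoryTheory.Functor.map_id _ _
  | cons a ρ hρ hn ih =>
    have h1 : (action x).map ρ = 𝟙 _ := by
      rcases hρ with hρ | hρ
      · exact hrel hρ
      · have := hrel hρ
        rw [action_map_inv] at this
        rw [← cancel_epi (Groupoid.inv ((action x).map ρ)), Groupoid.inv_comp, Category.comp_id,
          this]
    rw [Functor.map_comp, Functor.map_comp, Functor.map_comp, ih, h1, Category.id_comp,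
      Category.id_comp, ← Functor.map_comp, Groupoid.comp_inv, CategoryTheory.Functor.map_id]

/-- Two morphisms of the free product with the same class in the quotient act in the same way. -/
theorem act_eq_of_proj_eq {x y z : P1} {f g : F.of y ⟶ F.of z} (h : proj.map f = proj.map g) :
    (act f : NormalForm x y ≃ NormalForm x z) = act g := by
  have hrel : ∀ (c d : F) (f g : c ⟶ d), ModNormalClosure Rel f g →
      (action x).map f = (action x).map g := by
    intro c d f g h
    have h1 := action_eq_id_of_isConsequence x h
    rw [← cancel_epi ((action x).map (Groupoid.inv g)), ← Functor.map_comp, h1,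
      ← Functor.map_comp, Groupoid.inv_comp, CategoryTheory.Functor.map_id]
  exact congrArg (CategoryTheory.Quotient.lift _ (action x) hrel).map h

/-! ### Normal forms represent the morphisms of the quotient -/

/-- The trivial normal form. -/
noncomputable def NormalForm.one (x : P1) : NormalForm x x :=
  ⟨MobiusGerm.mk 1 (one_smul _ x), .nil x, by rw [Tail.IsNormal]; trivial⟩

theorem NormalForm.toF_mul {x y z : P1} (a : NormalForm x y) (g : MobiusGerm y z) :
    (a.mul g).toF = a.toF ≫ FreeProduct.inl mobiusGroupoid expGroupoid g := by
  rw [NormalForm.toF, NormalForm.toF, Category.assoc, inl_comp]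
  rfl

theorem NormalForm.toF_one (x : P1) : (NormalForm.one x).toF = 𝟙 (F.of x) := by
  rw [NormalForm.toF, NormalForm.one]
  dsimp only
  rw [inl_one, Tail.toF, Category.comp_id]

theorem act_edge {x v y : P1} {k : Kind} (J : k.Joins v y) {a : NormalForm x v}
    {b : NormalForm x y} (H : a.Step k b) :
    act (FreeProduct.inr mobiusGroupoid expGroupoid (k.edge J)) a = b := by
  cases k
  · exact (step_act_inr_expEdge J a).unique H
  · rw [inr_edge_l, act_inv_eq_iff]
    exact (step_act_inr_expEdge _ b).unique H.bar

/-- A normal form is recovered from its class by letting the class act on the trivial normal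
form. -/
theorem act_toF {x y : P1} (a : NormalForm x y) : act a.toF (NormalForm.one x) = a := by
  have key : ∀ {m : P1} (t : Tail x m) (ht : t.IsNormal),
      act t.toF (NormalForm.one x) = ⟨MobiusGerm.mk 1 (one_smul _ m), t, ht⟩ := by
    intro m t
    induction t with
    | nil => intro ht; rw [Tail.toF, act_id]; rfl
    | cons k J g p ih =>
      intro ht
      rw [Tail.toF, act_comp, act_comp, ih (Tail.isNormal_cons.mp ht).2.2, act_inl]
      exact act_edge J (.inl ⟨_, _, J, g, _, _, ht, (one_comp g).trans (comp_one g).symm,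
        Conj.one J.toEdge, rfl⟩)
  obtain ⟨g, t, ht⟩ := a
  rw [NormalForm.toF, act_comp, key t ht, act_inl]
  simp only [NormalForm.mul, one_comp]

/-- The relations hold in the quotient. -/
theorem proj_eq_of_relPair {c d : F} {u v : c ⟶ d} (h : RelPair u v) :
    proj.map u = proj.map v := by
  refine CategoryTheory.Quotient.sound _ ?_
  have := IsConsequence.cons (R := Rel) (𝟙 d) (Groupoid.inv v ≫ u) (.inl ⟨c, u, v, h, rfl⟩)
    (IsConsequence.id (R := Rel) (x := d))
  rw [Category.id_comp, Category.id_comp, Groupoid.inv_eq_inv (𝟙 d), IsIso.inv_id,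
    Category.comp_id] at this
  exact this

/-- The class in the quotient of the germ of a Möbius transformation. -/
noncomputable def mobQ {y z : P1} (g : MobiusGerm y z) :
    proj.obj (F.of y) ⟶ proj.obj (F.of z) :=
  proj.map (FreeProduct.inl mobiusGroupoid expGroupoid g)

theorem mobQ_comp {y z w : P1} (g : MobiusGerm y z) (h : MobiusGerm z w) :
    mobQ (g.comp h) = mobQ g ≫ mobQ h := by
  rw [mobQ, ← inl_comp, Functor.map_comp]
  rfl

/-- The class in the quotient of a germ of `exp` or of a branch of `log`. -/
noncomputable def edgeQ : ∀ (k : Kind) {y z : P1}, k.Edge y z →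
    (proj.obj (F.of y) ⟶ proj.obj (F.of z))
  | .e, _, _, h => proj.map (FreeProduct.inr mobiusGroupoid expGroupoid (expEdge h))
  | .l, _, _, h =>
    Groupoid.inv (proj.map (FreeProduct.inr mobiusGroupoid expGroupoid (expEdge h)))

theorem proj_map_edge {k : Kind} {y z : P1} (J : k.Joins y z) :
    proj.map (FreeProduct.inr mobiusGroupoid expGroupoid (k.edge J)) = edgeQ k J.toEdge := by
  cases k
  · rfl
  · rw [inr_edge_l, Groupoid.inv_eq_inv, Functor.map_inv, ← Groupoid.inv_eq_inv]
    rfl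

/-- The relation `e h = h' e` holds in the quotient for conjugate germs `h`, `h'`. -/
theorem expConj_comm {y z y' z' : P1} {h : MobiusGerm y z} {h' : MobiusGerm y' z'}
    (H : ExpConj h h') (E : Kind.e.Edge y y') (E' : Kind.e.Edge z z') :
    mobQ h ≫ edgeQ .e E' = edgeQ .e E ≫ mobQ h' := by
  have htrans : ∀ a z : ℂ, mobQ (MobiusGerm.mk (trans a) (mobius_trans a z)) ≫
      edgeQ .e ⟨z + a, rfl, rfl⟩ = edgeQ .e ⟨z, rfl, rfl⟩ ≫ mobQ (MobiusGerm.mk (scaleExp a)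
      (by rw [scaleExp, mobius_scale, Units.val_mk0, Complex.exp_add, mul_comm])) := by
    intro a z
    have := proj_eq_of_relPair (.exp_add a z)
    rw [Functor.map_comp, Functor.map_comp] at this
    exact this
  have hneg : ∀ z : ℂ, mobQ (MobiusGerm.mk (p := z) (q := (-z : ℂ)) (scale (-1))
        (by rw [mobius_scale]; simp)) ≫ edgeQ .e ⟨-z, rfl, rfl⟩ =
      edgeQ .e ⟨z, rfl, rfl⟩ ≫ mobQ (MobiusGerm.mk invol
        (by rw [mobius_invol (Complex.exp_ne_zero z), Complex.exp_neg])) := by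
    intro z
    have := proj_eq_of_relPair (.exp_neg z)
    rw [Functor.map_comp, Functor.map_comp] at this
    exact this
  obtain ⟨⟨z, rfl, rfl⟩, ⟨z', rfl, rfl⟩, a, ⟨e, e'⟩ | ⟨e, e'⟩⟩ := H
  · obtain rfl : z + a = z' :=
      OnePoint.coe_injective ((mobius_trans a z).symm.trans (mobius_apply_of_val_eq e))
    rw [eq_mk e, eq_mk e']
    exact htrans a z
  · obtain rfl : -z + a = z' :=
      OnePoint.coe_injective ((mobius_trans_scale_neg a z).symm.trans (mobius_apply_of_val_eq e))
    rw [eq_mk e, eq_mk e', ← mk_comp_mk (mobius_scale _ z |>.trans (by simp)) (mobius_trans a (-z)),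
      ← mk_comp_mk (q := (Complex.exp (-z) : ℂ)) (B := scaleExp a)
        (by rw [mobius_invol (Complex.exp_ne_zero z), Complex.exp_neg])
        (by rw [scaleExp, mobius_scale, Units.val_mk0, Complex.exp_add, mul_comm]),
      mobQ_comp, mobQ_comp, Category.assoc, htrans, reassoc_of% (hneg z)]

theorem Conj.comm {k : Kind} {y z y' z' : P1} {h : MobiusGerm y z} {h' : MobiusGerm y' z'}
    (H : Conj k h h') : mobQ h ≫ edgeQ k H.target = edgeQ k H.source ≫ mobQ h' := by
  cases k
  · exact expConj_comm H _ _
  · have := expConj_comm (h := h') (h' := h) H H.1 H.2.1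
    rw [edgeQ, edgeQ, Groupoid.inv_eq_inv, Groupoid.inv_eq_inv, IsIso.comp_inv_eq, Category.assoc,
      IsIso.eq_inv_comp]
    exact this.symm

theorem NormalForm.proj_toF {x y : P1} (a : NormalForm x y) :
    proj.map a.toF = proj.map a.tail.toF ≫ mobQ a.g₀ := by
  rw [NormalForm.toF, Functor.map_comp]
  rfl

theorem NormalForm.Push.proj_toF {k : Kind} {x v y : P1} {a : NormalForm x v}
    {b : NormalForm x y} (H : Push k a b) (E : k.Edge v y) :
    proj.map b.toF = proj.map a.toF ≫ edgeQ k E := by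
  obtain ⟨v₀, y₀, J, τ, h, h', hn, hg, hc, rfl⟩ := H
  rw [NormalForm.proj_toF, NormalForm.proj_toF, hg, mobQ_comp, Category.assoc, Category.assoc,
    hc.comm, Tail.toF, Functor.map_comp, Functor.map_comp, proj_map_edge]
  simp only [Category.assoc]
  rfl

theorem NormalForm.Step.proj_toF {x v y : P1} {a : NormalForm x v}
    {b : NormalForm x y} (H : Step .e a b) (E : Kind.e.Edge v y) :
    proj.map b.toF = proj.map a.toF ≫ edgeQ .e E := by
  rcases H with H | H
  · exact H.proj_toF E
  · have h : proj.map a.toF = proj.map b.toF ≫ Groupoid.inv (edgeQ .e E) := H.proj_toF E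
    rw [h, Category.assoc, Groupoid.inv_comp, Category.comp_id]

/-- The action of the morphism `f` on a normal form multiplies the class of the normal form by that
of `f`. -/
def ActsByMul (x : P1) {y z : P1} (f : F.of y ⟶ F.of z) : Prop :=
  ∀ a : NormalForm x y, proj.map (act f a).toF = proj.map a.toF ≫ proj.map f

namespace ActsByMul

variable {x y z w : P1}

theorem id : ActsByMul x (𝟙 (F.of y)) := fun a => by
  rw [act_id, CategoryTheory.Functor.map_id, Category.comp_id]

theorem comp {f : F.of y ⟶ F.of z} {g : F.of z ⟶ F.of w} (hf : ActsByMul x f)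
    (hg : ActsByMul x g) : ActsByMul x (f ≫ g) := fun a => by
  rw [act_comp, hg, hf, Functor.map_comp, Category.assoc]

theorem inv {f : F.of y ⟶ F.of z} (hf : ActsByMul x f) : ActsByMul x (Groupoid.inv f) :=
  fun a => by
    have h := hf (act (Groupoid.inv f) a)
    rw [act_inv_eq_iff.mp rfl] at h
    rw [h, Category.assoc, ← Functor.map_comp, Groupoid.comp_inv, CategoryTheory.Functor.map_id,
      Category.comp_id]

theorem inl (g : MobiusGerm y z) :
    ActsByMul x (FreeProduct.inl mobiusGroupoid expGroupoid g) := fun a => by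
  rw [act_inl, NormalForm.toF_mul, Functor.map_comp]

theorem inr (f : expGroupoid.Hom y z) :
    ActsByMul x (FreeProduct.inr mobiusGroupoid expGroupoid f) := by
  refine freeGroupoid_induction (V := ExpGraph)
    (fun {p q} f => ActsByMul x (y := p.as) (z := q.as)
      (FreeProduct.inr mobiusGroupoid expGroupoid (x := p.as) (y := q.as) f))
    (fun p => ?_) (fun {p q} f => ?_) (fun {p q} f hf => ?_) (fun {p q r} f g hf hg => ?_) f
  · have := inr_one p.as
    exact this ▸ ActsByMul.id
  · obtain ⟨φ, h, rfl⟩ := f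
    exact fun a => (step_act_inr_expEdge h a).proj_toF h
  · have := inr_inv (y := p.as) (z := q.as) f
    exact this ▸ hf.inv
  · have := inr_comp (y := p.as) (z := q.as) (w := r.as) f g
    exact this ▸ hf.comp hg

end ActsByMul

theorem actsByMul {x y z : P1} (f : F.of y ⟶ F.of z) : ActsByMul x f := by
  obtain ⟨f, rfl⟩ := (CategoryTheory.Quotient.functor _).map_surjective f
  refine freeGroupoid_induction (V := JoinGraph mobiusGroupoid expGroupoid)
    (fun {p q} f => ActsByMul x (y := p.as) (z := q.as)
      ((CategoryTheory.Quotient.functor (MulRel mobiusGroupoid expGroupoid)).map f))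
    (fun p => ?_) (fun {p q} f => ?_) (fun {p q} f hf => ?_) (fun {p q r} f g hf hg => ?_) f
  · have := (CategoryTheory.Quotient.functor (MulRel mobiusGroupoid expGroupoid)).map_id p
    exact this ▸ ActsByMul.id
  · rcases f with f | f
    · exact ActsByMul.inl f
    · exact ActsByMul.inr f
  · exact hf.inv
  · exact hf.comp hg

end ExpMobius

open ExpMobius in
theorem mainTheorem8 (x y : ExpMobius.P1)
    (γ : ExpMobius.proj.obj (ExpMobius.F.of x) ⟶ ExpMobius.proj.obj (ExpMobius.F.of y)) :
    ∃! g : ExpMobius.NormalForm x y, ExpMobius.proj.map g.toF = γ := by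
  obtain ⟨f, rfl⟩ := proj.map_surjective γ
  refine ⟨act f (NormalForm.one x), ?_, fun g hg => ?_⟩
  · change proj.map (act f (NormalForm.one x)).toF = _
    rw [actsByMul f, NormalForm.toF_one, CategoryTheory.Functor.map_id, Category.id_comp]
  · rw [← act_eq_of_proj_eq hg, act_toF]
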